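/- Graphs are finite and undirected, may have loops and multiple edges, and have no isolated vertices. For a graph $G=(V,E)$, the cosmological polytope $\mathcal{C}_G\subset\mathbb{R}^{V\cup E}$ is the convex hull of the points $\mathbf{e}_i+\mathbf{e}_j-\mathbf{e}_f$, $\mathbf{e}_i-\mathbf{e}_j+\mathbf{e}_f$ and $-\mathbf{e}_i+\mathbf{e}_j+\mathbf{e}_f$ over all edges $f=ij\in E$, where $\mathbf{e}_\alpha$ ($\alpha\in V\cup E$) are the standard unit vectors. The $h^\ast$-polynomial of a lattice polytope $P\subset\mathbb{R}^n$ of dimension $d$ is the polynomial $h^\ast(P;z)$ with $$1+\sum_{t>0}|tP\cap\mathbb{Z}^n|\,z^t=\frac{h^\ast(P;z)}{(1-z)^{d+1}}.$$ For graphs $G_1$, $G_2$ on disjoint vertex sets and vertices $v$ of $G_1$ and $w$ of $G_2$, the $1$-sum $G_1\oplus_{v,w}G_2$ is obtained from the disjoint union of $G_1$ and $G_2$ by identifying $v$ and $w$ to one new vertex, keeping all edges (with multiplicity). **Theorem.** Let $G=G_1\oplus_{v,w}G_2$ be a $1$-sum of graphs $G_1$ and $G_2$. Then the $h^\ast$-polynomials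 of $\mathcal{C}_G$, $\mathcal{C}_{G_1}$ and $\mathcal{C}_{G_2}$ exist and satisfy $$h^\ast(\mathcal{C}_G;z)=h^\ast(\mathcal{C}_{G_1};z)\cdot h^\ast(\mathcal{C}_{G_2};z).$$ -/

import Mathlib

/-!
Multigraphs (loops and parallel edges allowed) are Mathlib's `Graph α β`: `G.vertexSet : Set α`,
`G.edgeSet : Set β`, and `G.IsLink f i j` says that the edge `f` has ends `i` and `j`.
-/

namespace Cosmological

/-- No vertex of `G` is isolated: every vertex is an end of some edge (possibly a loop). -/
def NoIsolatedVertices {α β : Type*} (G : Graph α β) : Prop :=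
  ∀ x ∈ G.vertexSet, ∃ f, G.Inc f x

/-- The map on the vertices of the first summand: `v` goes to the new vertex `none`. -/
noncomputable def glueLeft {α₁ : Type*} (α₂ : Type*) (v : α₁) (a : α₁) : Option (α₁ ⊕ α₂) :=
  open scoped Classical in if a = v then none else some (Sum.inl a)

/-- The map on the vertices of the second summand: `w` goes to the new vertex `none`. -/
noncomputable def glueRight (α₁ : Type*) {α₂ : Type*} (w : α₂) (a : α₂) : Option (α₁ ⊕ α₂) :=
  open scoped Classical in if a = w then none else some (Sum.inr a)

/-- The 1-sum of `G` and `H` with respect to `v` and `w`. Its vertices are those of the disjoint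
union of `G` and `H` other than `v` and `w`, together with one new vertex `none` which replaces
both `v` and `w`; its edges are the disjoint union of those of `G` and `H`, where each end that
was `v` or `w` becomes the new vertex. -/
def oneSum {α₁ α₂ β₁ β₂ : Type*} (G : Graph α₁ β₁) (H : Graph α₂ β₂) (v : α₁) (w : α₂) :
    Graph (Option (α₁ ⊕ α₂)) (β₁ ⊕ β₂) where
  vertexSet := insert none
    (some '' (Sum.inl '' (G.vertexSet \ {v}) ∪ Sum.inr '' (H.vertexSet \ {w})))
  edgeSet := Sum.inl '' G.edgeSet ∪ Sum.inr '' H.edgeSet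
  IsLink f x y :=
    match f with
    | Sum.inl e => ∃ i j, G.IsLink e i j ∧ x = glueLeft α₂ v i ∧ y = glueLeft α₂ v j
    | Sum.inr e => ∃ i j, H.IsLink e i j ∧ x = glueRight α₁ w i ∧ y = glueRight α₁ w j
  isLink_symm := by
    rintro (e | e) _ <;> refine ⟨?_⟩ <;> rintro x y ⟨i, j, h, rfl, rfl⟩ <;>
      exact ⟨j, i, h.symm, rfl, rfl⟩
  eq_or_eq_of_isLink_of_isLink := by
    rintro (e | e) _ _ _ _ ⟨i, j, h, rfl, rfl⟩ ⟨i', j', h', rfl, rfl⟩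
    · rcases G.eq_or_eq_of_isLink_of_isLink h h' with rfl | rfl
      · exact Or.inl rfl
      · exact Or.inr rfl
    · rcases H.eq_or_eq_of_isLink_of_isLink h h' with rfl | rfl
      · exact Or.inl rfl
      · exact Or.inr rfl
  edge_mem_iff_exists_isLink := by
    rintro (e | e)
    · constructor
      · rintro (⟨e', he, h⟩ | ⟨e', he, h⟩)
        · cases h
          obtain ⟨i, j, hij⟩ := (G.edge_mem_iff_exists_isLink e).1 he
          exact ⟨_, _, i, j, hij, rfl, rfl⟩
        · cases h
      · rintro ⟨_, _, i, j, hij, -, -⟩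
        exact Or.inl ⟨e, (G.edge_mem_iff_exists_isLink e).2 ⟨i, j, hij⟩, rfl⟩
    · constructor
      · rintro (⟨e', he, h⟩ | ⟨e', he, h⟩)
        · cases h
        · cases h
          obtain ⟨i, j, hij⟩ := (H.edge_mem_iff_exists_isLink e).1 he
          exact ⟨_, _, i, j, hij, rfl, rfl⟩
      · rintro ⟨_, _, i, j, hij, -, -⟩
        exact Or.inr ⟨e, (H.edge_mem_iff_exists_isLink e).2 ⟨i, j, hij⟩, rfl⟩
  left_mem_of_isLink := by
    rintro (e | e) _ _ ⟨i, j, h, rfl, rfl⟩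
    · by_cases hi : i = v
      · exact Or.inl (by simp [glueLeft, hi])
      · exact Or.inr ⟨Sum.inl i, Or.inl ⟨i, ⟨h.left_mem, hi⟩, rfl⟩, by simp [glueLeft, hi]⟩
    · by_cases hi : i = w
      · exact Or.inl (by simp [glueRight, hi])
      · exact Or.inr ⟨Sum.inr i, Or.inr ⟨i, ⟨h.left_mem, hi⟩, rfl⟩, by simp [glueRight, hi]⟩

/-- The standard unit vector indexed by `k`. -/
noncomputable def unitVec {ι : Type*} (k : ι) : ι → ℝ :=
  open scoped Classical in Pi.single k 1

/-- The cosmological polytope of `G` in `ℝ^(V ∪ E)` (with `V ∪ E` a disjoint union): the convex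
hull of `e_i + e_j - e_f`, `e_i - e_j + e_f` and `-e_i + e_j + e_f`, over all edges `f` with ends
`i` and `j`. -/
noncomputable def cosmologicalPolytope {α β : Type*} (G : Graph α β) :
    Set (G.vertexSet ⊕ G.edgeSet → ℝ) :=
  convexHull ℝ {p | ∃ (f : G.edgeSet) (i j : G.vertexSet), G.IsLink f i j ∧
    (p = unitVec (Sum.inl i) + unitVec (Sum.inl j) - unitVec (Sum.inr f) ∨
     p = unitVec (Sum.inl i) - unitVec (Sum.inl j) + unitVec (Sum.inr f) ∨
     p = -unitVec (Sum.inl i) + unitVec (Sum.inl j) + unitVec (Sum.inr f))}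

/-- The number of lattice points of the `t`-th dilate of `P`. -/
noncomputable def latticeCount {ι : Type*} (P : Set (ι → ℝ)) (t : ℕ) : ℕ :=
  Set.ncard {x : ι → ℤ | ∃ p ∈ P, ∀ k, (x k : ℝ) = (t : ℝ) * p k}

/-- The Ehrhart series `1 + ∑_{t > 0} |tP ∩ ℤ^n| z^t`. -/
noncomputable def ehrhartSeries {ι : Type*} (P : Set (ι → ℝ)) : PowerSeries ℤ :=
  PowerSeries.mk fun t => if t = 0 then 1 else (latticeCount P t : ℤ)

/-- The dimension of (the affine hull of) a nonempty polytope. -/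
noncomputable def polytopeDim {ι : Type*} (P : Set (ι → ℝ)) : ℕ :=
  Module.finrank ℝ (affineSpan ℝ P).direction

/-- The polynomial `h` is the `h^*`-polynomial of `P`: `Ehr(P; z) = h(z) / (1 - z)^(dim P + 1)`.
As `1 - z` is invertible in `ℤ⟦z⟧`, there is at most one such polynomial. -/
def IsHStarPolynomial {ι : Type*} (P : Set (ι → ℝ)) (h : Polynomial ℤ) : Prop :=
  (h : PowerSeries ℤ) = (1 - PowerSeries.X) ^ (polytopeDim P + 1) * ehrhartSeries P

end Cosmological

/-!
Every generator of a cosmological polytope has coordinate sum `1`, and all unit vectors lie in the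
polytope, so `dim C_G + 1 = |V| + |E|` and lattice points of the cone over `C_G` are graded by their
coordinate sum. A 1-sum has one vertex fewer than the disjoint union, so the product formula
amounts to `Ehr(G) = (1 - z) * Ehr(G₁) * Ehr(G₂)`.

The dual cone consists of the weights on vertices and edges which satisfy the triangle inequalities
`|c i - c j| ≤ c f ≤ c i + c j` at each edge `f = ij`. Optimizing over the edge weights and cutting
the vertex weights at their level sets shows that an integer point lies in the cone if and only if
`cutValue s t x c ≥ 0` for every indicator function `c` of a set of vertices
(`mem_coneLayer_edgeGen_iff`). In these inequalities the coordinate of a vertex has coefficient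
`0` or `1`. Hence, given the other coordinates of an integer point, the least admissible value of
the coordinate at `v` is an integer, attained where a cut through `v` is tight. Combining that tight
cut with cuts of `G₂` shows that every integer point of `G₁ ⊕ G₂` is uniquely the sum of a point
of `G₁` which is minimal at `v` and a point of `G₂` (`ncard_cutLayer_glue`). The minimal points have
generating function `(1 - z) * Ehr(G₁)`, as adding the unit vector of `v` stays in the cone.

That the `h^*`-polynomials exist is Ehrhart's theorem, proved for lattice polytopes in the
hyperplane of coordinate sum `1` (`hasPoleOrderLE_ehrhartSeries`): lattice points of the cone are
represented as a nonnegative integer combination of the generators plus a point of a finite set, and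
the lexicographically least representations form finitely many lower sets of `ℕ ^ m`, whose
generating functions are rational by Dickson's lemma. The order of the pole at `1` is then bounded
by the growth of the number of lattice points.
-/

namespace Cosmological

/-! ### Generating functions of lower sets and bounds on the pole order -/

/-- `F` is a polynomial divided by `(1 - z) ^ d`. -/
def HasPoleOrderLE (d : ℕ) (F : PowerSeries ℤ) : Prop :=
  ∃ p : Polynomial ℤ, (1 - PowerSeries.X) ^ d * F = (p : PowerSeries ℤ)

theorem HasPoleOrderLE.zero (d : ℕ) : HasPoleOrderLE d 0 := ⟨0, by simp⟩

theorem HasPoleOrderLE.add {d : ℕ} {F G : PowerSeries ℤ} (hF : HasPoleOrderLE d F)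
    (hG : HasPoleOrderLE d G) : HasPoleOrderLE d (F + G) := by
  obtain ⟨p, hp⟩ := hF
  obtain ⟨q, hq⟩ := hG
  exact ⟨p + q, by rw [mul_add, hp, hq, Polynomial.coe_add]⟩

theorem HasPoleOrderLE.sum {ι : Type*} {d : ℕ} (s : Finset ι) (F : ι → PowerSeries ℤ)
    (hF : ∀ i ∈ s, HasPoleOrderLE d (F i)) : HasPoleOrderLE d (∑ i ∈ s, F i) :=
  Finset.sum_induction _ _ (fun _ _ => HasPoleOrderLE.add) (HasPoleOrderLE.zero d) hF

theorem HasPoleOrderLE.X_pow_mul {d : ℕ} {F : PowerSeries ℤ} (hF : HasPoleOrderLE d F) (k : ℕ) :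
    HasPoleOrderLE d (PowerSeries.X ^ k * F) := by
  obtain ⟨p, hp⟩ := hF
  exact ⟨Polynomial.X ^ k * p, by
    rw [mul_left_comm, hp, Polynomial.coe_mul, Polynomial.coe_pow, Polynomial.coe_X]⟩

theorem HasPoleOrderLE.mono {d e : ℕ} {F : PowerSeries ℤ} (hF : HasPoleOrderLE d F) (h : d ≤ e) :
    HasPoleOrderLE e F := by
  obtain ⟨p, hp⟩ := hF
  refine ⟨(1 - Polynomial.X) ^ (e - d) * p, ?_⟩
  rw [Polynomial.coe_mul, Polynomial.coe_pow, Polynomial.coe_sub, Polynomial.coe_one,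
    Polynomial.coe_X, ← hp, ← mul_assoc, ← pow_add, Nat.sub_add_cancel h]

theorem finite_setOf_sum_eq (m t : ℕ) : {a : Fin m → ℕ | ∑ i, a i = t}.Finite := by
  refine (Set.finite_Icc (0 : Fin m → ℕ) fun _ => t).subset fun a ha => ⟨fun i => Nat.zero_le _, ?_⟩
  intro i
  rw [← (show ∑ i, a i = t from ha)]
  exact Finset.single_le_sum (f := a) (fun _ _ => Nat.zero_le _) (Finset.mem_univ i)

/-- A consequence of Dickson's lemma: descending chains of lower sets are finite. -/
theorem wellFoundedLT_lowerSet (α : Type*) [PartialOrder α] [WellQuasiOrderedLE α] :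
    WellFoundedLT (LowerSet α) := by
  refine ⟨RelEmbedding.wellFounded_iff_isEmpty.2 ⟨fun f => ?_⟩⟩
  have hlt : ∀ n, f (n + 1) < f n := fun n => f.map_rel_iff.2 (Nat.lt_succ_self n)
  have hanti : Antitone f := antitone_nat_of_succ_le fun n => (hlt n).le
  have hx : ∀ n, ∃ x, x ∈ f n ∧ x ∉ f (n + 1) := fun n =>
    Set.not_subset.1 (fun h => (hlt n).not_ge h)
  choose x hx1 hx2 using hx
  obtain ⟨i, j, hij, hle⟩ := wellQuasiOrdered_le (α := α) x
  exact hx2 i ((f (i + 1)).lower hle (hanti hij (hx1 j)))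

/-- The generating function, by coordinate sum, of a set of points of `ℕ ^ m`. -/
noncomputable def sumSeries {m : ℕ} (L : Set (Fin m → ℕ)) : PowerSeries ℤ :=
  PowerSeries.mk fun t => ({a | a ∈ L ∧ ∑ i, a i = t}.ncard : ℤ)

/-- Splitting a lower set into its slice with first coordinate `0` and the rest, translated. -/
theorem sumSeries_succ {m : ℕ} (L : Set (Fin (m + 1) → ℕ)) :
    sumSeries L = sumSeries {a | Fin.cons 0 a ∈ L} +
      PowerSeries.X * sumSeries {a | a + Pi.single 0 1 ∈ L} := by
  ext t
  have hsum : ∀ a : Fin (m + 1) → ℕ,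
      ∑ i, (a + Pi.single 0 1 : Fin (m + 1) → ℕ) i = ∑ i, a i + 1 := by
    intro a
    simp [Finset.sum_add_distrib]
  have h0 : ({a : Fin (m + 1) → ℕ | a ∈ L ∧ ∑ i, a i = t ∧ a 0 = 0}).ncard =
      {a : Fin m → ℕ | Fin.cons 0 a ∈ L ∧ ∑ i, a i = t}.ncard := by
    symm
    refine Set.ncard_congr (fun a _ => Fin.cons 0 a) ?_ ?_ ?_
    · rintro a ⟨h1, h2⟩
      exact ⟨h1, by simpa [Fin.sum_univ_succ] using h2, rfl⟩
    · intro a b _ _ h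
      exact Fin.cons_right_injective (α := fun _ => ℕ) 0 h
    · rintro a ⟨h1, h2, h3⟩
      have hcons : Fin.cons 0 (Fin.tail a) = a := by
        rw [← h3]; exact Fin.cons_self_tail a
      refine ⟨Fin.tail a, ⟨?_, ?_⟩, hcons⟩
      · show Fin.cons 0 (Fin.tail a) ∈ L
        rwa [hcons]
      · rw [Fin.sum_univ_succ, h3, zero_add] at h2
        exact h2
  have hsplit : {a : Fin (m + 1) → ℕ | a ∈ L ∧ ∑ i, a i = t} =
      {a | a ∈ L ∧ ∑ i, a i = t ∧ a 0 = 0} ∪ {a | a ∈ L ∧ ∑ i, a i = t ∧ a 0 ≠ 0} := by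
    ext a
    simp only [Set.mem_ofPred_eq, Set.mem_union]
    tauto
  have hcard : {a : Fin (m + 1) → ℕ | a ∈ L ∧ ∑ i, a i = t}.ncard =
      {a : Fin (m + 1) → ℕ | a ∈ L ∧ ∑ i, a i = t ∧ a 0 = 0}.ncard +
      {a : Fin (m + 1) → ℕ | a ∈ L ∧ ∑ i, a i = t ∧ a 0 ≠ 0}.ncard := by
    rw [hsplit]
    refine Set.ncard_union_eq ?_ ((finite_setOf_sum_eq _ t).subset fun a ha => ha.2.1)
      ((finite_setOf_sum_eq _ t).subset fun a ha => ha.2.1)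
    rw [Set.disjoint_left]
    rintro a ⟨_, _, h⟩ ⟨_, _, h'⟩
    exact h' h
  rw [map_add, sumSeries, PowerSeries.coeff_mk, hcard, h0]
  push_cast
  rw [sumSeries, PowerSeries.coeff_mk]
  congr 1
  cases t with
  | zero =>
    rw [PowerSeries.coeff_zero_X_mul]
    norm_cast
    rw [Set.ncard_eq_zero ((finite_setOf_sum_eq _ 0).subset fun a ha => ha.2.1)]
    ext a
    simp only [Set.mem_ofPred_eq, Set.mem_empty_iff_false, iff_false]
    rintro ⟨_, h2, h3⟩
    exact h3 (Finset.sum_eq_zero_iff.1 h2 0 (Finset.mem_univ _))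
  | succ t =>
    rw [PowerSeries.coeff_succ_X_mul, sumSeries, PowerSeries.coeff_mk]
    norm_cast
    symm
    refine Set.ncard_congr (fun a _ => a + Pi.single 0 1) ?_ ?_ ?_
    · rintro a ⟨h1, h2⟩
      exact ⟨h1, by rw [hsum, h2], by simp⟩
    · intro a b _ _ h
      exact add_right_cancel h
    · rintro a ⟨h1, h2, h3⟩
      have hle : Pi.single 0 1 ≤ a := by
        intro i
        rcases eq_or_ne i 0 with rfl | hi
        · simpa using Nat.one_le_iff_ne_zero.2 h3
        · simp [hi]
      have hsub : a - Pi.single 0 1 + Pi.single 0 1 = a := tsub_add_cancel_of_le hle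
      refine ⟨a - Pi.single 0 1, ⟨?_, ?_⟩, hsub⟩
      · show a - Pi.single 0 1 + Pi.single 0 1 ∈ L
        rwa [hsub]
      · have := hsum (a - Pi.single 0 1)
        rw [hsub, h2] at this
        omega

/-- The Hilbert series of a lower set of `ℕ ^ m` (the complement of a monomial ideal): translating
by the first unit vector gives a descending chain of lower sets, which becomes stationary. -/
theorem hasPoleOrderLE_sumSeries {m : ℕ} (L : LowerSet (Fin m → ℕ)) :
    HasPoleOrderLE m (sumSeries (L : Set (Fin m → ℕ))) := by
  induction m with
  | zero =>
    refine ⟨Polynomial.C (({a | a ∈ (L : Set (Fin 0 → ℕ)) ∧ ∑ i, a i = 0}.ncard : ℕ) : ℤ), ?_⟩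
    ext t
    rw [pow_zero, one_mul, sumSeries, PowerSeries.coeff_mk, Polynomial.coeff_coe,
      Polynomial.coeff_C]
    rcases eq_or_ne t 0 with rfl | ht
    · simp
    · simp [ht, ht.symm]
  | succ m ih =>
    have hwf : WellFoundedLT (LowerSet (Fin (m + 1) → ℕ)) := wellFoundedLT_lowerSet _
    induction L using hwf.induction with
    | _ L ihL =>
      let L0 : LowerSet (Fin m → ℕ) :=
        { carrier := {a | (Fin.cons 0 a : Fin (m + 1) → ℕ) ∈ (L : Set (Fin (m + 1) → ℕ))}
          lower' := fun a b hab ha => L.lower (Fin.cons_le_cons.2 ⟨le_rfl, hab⟩) ha }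
      let L1 : LowerSet (Fin (m + 1) → ℕ) :=
        { carrier := {a | a + Pi.single 0 1 ∈ (L : Set (Fin (m + 1) → ℕ))}
          lower' := fun a b hab ha => L.lower (add_le_add_left hab _) ha }
      have hrec : sumSeries (L : Set (Fin (m + 1) → ℕ)) =
          sumSeries (L0 : Set (Fin m → ℕ)) +
            PowerSeries.X * sumSeries (L1 : Set (Fin (m + 1) → ℕ)) :=
        sumSeries_succ (L : Set (Fin (m + 1) → ℕ))
      have hle : L1 ≤ L := fun a (ha : a + Pi.single 0 1 ∈ L) =>
        L.lower (le_add_of_nonneg_right fun _ => Nat.zero_le _) ha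
      rcases hle.eq_or_lt with heq | hlt
      · -- here `sumSeries L = sumSeries L0 + X * sumSeries L`
        obtain ⟨p, hp⟩ := ih L0
        refine ⟨p, ?_⟩
        rw [heq] at hrec
        rw [← hp, pow_succ, mul_assoc]
        congr 1
        rw [sub_mul, one_mul, sub_eq_iff_eq_add]
        exact hrec
      · rw [hrec]
        refine ((ih L0).mono (Nat.le_succ m)).add ?_
        simpa using (ihL L1 hlt).X_pow_mul 1

/-- A pole of order greater than `d + 1` at `z = 1` forces the coefficients to grow faster than
`t ^ d`. -/
theorem HasPoleOrderLE.of_coeff_le {m d : ℕ} {F : PowerSeries ℤ} (hF : HasPoleOrderLE m F)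
    (C : ℕ) (hC : ∀ t, |PowerSeries.coeff t F| ≤ C * (t + 1) ^ d) : HasPoleOrderLE (d + 1) F := by
  induction m with
  | zero => exact hF.mono (Nat.zero_le _)
  | succ k ih =>
    rcases le_or_gt k d with hk | hk
    · exact hF.mono (Nat.succ_le_succ hk)
    apply ih
    obtain ⟨p, hp⟩ := hF
    suffices hroot : p.IsRoot 1 by
      obtain ⟨q, rfl⟩ := Polynomial.dvd_iff_isRoot.2 hroot
      refine ⟨-q, ?_⟩
      have hne : (1 - PowerSeries.X : PowerSeries ℤ) ≠ 0 := by
        intro h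
        have := congrArg (PowerSeries.coeff 0) h
        simp at this
      apply mul_left_cancel₀ hne
      rw [← mul_assoc, ← pow_succ', hp]
      rw [Polynomial.coe_mul, Polynomial.coe_neg, map_one, Polynomial.coe_sub, Polynomial.coe_X,
        Polynomial.coe_one]
      ring
    by_contra hroot
    set P : Polynomial ℚ := p.map (Int.castRingHom ℚ) with hP
    have hroot' : ¬ P.IsRoot 1 := by
      intro h
      apply hroot
      rw [Polynomial.IsRoot, hP, Polynomial.eval_one_map] at h
      simpa using h
    have hP0 : P ≠ 0 := by rintro h; exact hroot' (by simp [h])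
    have hmult : P.rootMultiplicity 1 = 0 := Polynomial.rootMultiplicity_eq_zero hroot'
    have hdeg := Polynomial.natDegree_hilbertPoly_of_ne_zero_of_rootMultiplicity_lt (d := k + 1) hP0
      (by omega)
    set H := Polynomial.hilbertPoly P (k + 1) with hH
    -- for large `t` the coefficients of `F` are the values of the Hilbert polynomial `H`
    have hcoeff : ∀ t, P.natDegree < t → H.eval (t : ℚ) = ((PowerSeries.coeff t F : ℤ) : ℚ) := by
      intro t ht
      rw [hH, ← Polynomial.coeff_mul_invOneSubPow_eq_hilbertPoly_eval (k + 1) ht]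
      have hF : (P : PowerSeries ℚ) * (PowerSeries.invOneSubPow ℚ (k + 1)).val =
          PowerSeries.map (Int.castRingHom ℚ) F := by
        rw [hP, Polynomial.polynomial_map_coe, ← hp]
        rw [map_mul, map_pow, map_sub, map_one, PowerSeries.map_X, mul_right_comm,
          ← PowerSeries.invOneSubPow_inv_eq_one_sub_pow]
        simp
      rw [hF, PowerSeries.coeff_map]
      rfl
    have hlt : ((Polynomial.X + 1 : Polynomial ℚ) ^ d).degree < H.degree := by
      have h1 : ((Polynomial.X + 1 : Polynomial ℚ) ^ d).degree ≤ d := by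
        have := Polynomial.degree_pow_le_of_le d
          (show (Polynomial.X + 1 : Polynomial ℚ).degree ≤ 1 by compute_degree)
        simpa using this
      refine h1.trans_lt (Polynomial.coe_lt_degree.2 ?_)
      omega
    have htend := (Polynomial.abs_div_tendsto_atTop_atTop_of_degree_gt H _ hlt
      (pow_ne_zero _ (Polynomial.X_add_C_ne_zero 1))).comp (tendsto_natCast_atTop_atTop (R := ℚ))
    obtain ⟨t, ht1, ht2⟩ := ((htend.eventually_gt_atTop (C : ℚ)).and
      (Filter.eventually_gt_atTop P.natDegree)).exists
    simp only [Function.comp, Polynomial.eval_pow, Polynomial.eval_add, Polynomial.eval_X,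
      Polynomial.eval_one, hcoeff t ht2, abs_div] at ht1
    have hpos : (0 : ℚ) < (t + 1) ^ d := by positivity
    rw [abs_of_pos hpos, lt_div_iff₀ hpos] at ht1
    have := hC t
    have h3 : ((|PowerSeries.coeff t F| : ℤ) : ℚ) ≤ C * (t + 1) ^ d := by exact_mod_cast this
    rw [Int.cast_abs] at h3
    exact absurd ht1 (not_lt.2 h3)

/-! ### Rationality of the Ehrhart series of a lattice polytope -/

/-- The polytope spanned by finitely many integer points. -/
def latticePolytope {ι κ : Type*} (g : κ → ι → ℤ) : Set (ι → ℝ) :=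
  convexHull ℝ (Set.range fun i k => (g i k : ℝ))

/-- The integer points of the cone over the points `g i` which are nonnegative combinations of
the `g i` with total weight `t`. -/
def coneLayer {ι κ : Type*} [Fintype κ] (g : κ → ι → ℤ) (t : ℕ) : Set (ι → ℤ) :=
  {x | ∃ w : κ → ℝ, (∀ i, 0 ≤ w i) ∧ ∑ i, w i = t ∧ ∀ k, (x k : ℝ) = ∑ i, w i * g i k}

theorem mem_latticePolytope_iff {ι κ : Type*} [Fintype κ] (g : κ → ι → ℤ)
    (p : ι → ℝ) : p ∈ latticePolytope g ↔
      ∃ w : κ → ℝ, (∀ i, 0 ≤ w i) ∧ ∑ i, w i = 1 ∧ ∀ k, p k = ∑ i, w i * g i k := by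
  classical
  have h : latticePolytope g =
      Fintype.linearCombination ℝ (fun i k => (g i k : ℝ)) '' stdSimplex ℝ κ := by
    rw [← convexHull_rangle_single_eq_stdSimplex, LinearMap.image_convexHull, ← Set.range_comp,
      latticePolytope]
    congr 2
    funext i
    simp [Fintype.linearCombination_apply_single]
  rw [h]
  constructor
  · rintro ⟨w, ⟨h1, h2⟩, rfl⟩
    exact ⟨w, h1, h2, fun k => by simp [Fintype.linearCombination_apply]⟩
  · rintro ⟨w, h1, h2, h3⟩
    exact ⟨w, ⟨h1, h2⟩, by ext k; simp [Fintype.linearCombination_apply, h3]⟩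

theorem mem_coneLayer_of_div_mem {ι κ : Type*} [Fintype κ] {g : κ → ι → ℤ} {T : ℕ} (hT : 0 < T)
    {x : ι → ℤ} (hx : (fun k => (x k : ℝ) / T) ∈ latticePolytope g) : x ∈ coneLayer g T := by
  have hT' : (T : ℝ) ≠ 0 := by exact_mod_cast hT.ne'
  obtain ⟨w, h1, h2, h3⟩ := (mem_latticePolytope_iff g _).1 hx
  refine ⟨fun i => T * w i, fun i => mul_nonneg T.cast_nonneg (h1 i), ?_, fun k => ?_⟩
  · rw [← Finset.mul_sum, h2, mul_one]
  · have := h3 k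
    rw [div_eq_iff hT'] at this
    rw [this, Finset.sum_mul]
    exact Finset.sum_congr rfl fun i _ => by ring

theorem div_mem_of_mem_coneLayer {ι κ : Type*} [Fintype κ] {g : κ → ι → ℤ} {T : ℕ} (hT : 0 < T)
    {x : ι → ℤ} (hx : x ∈ coneLayer g T) : (fun k => (x k : ℝ) / T) ∈ latticePolytope g := by
  obtain ⟨w, h1, h2, h3⟩ := hx
  have hT' : (0 : ℝ) < T := by exact_mod_cast hT
  refine (mem_latticePolytope_iff g _).2
    ⟨fun i => w i / T, fun i => div_nonneg (h1 i) hT'.le, ?_, fun k => ?_⟩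
  · rw [← Finset.sum_div, h2, div_self hT'.ne']
  · rw [h3, Finset.sum_div]
    exact Finset.sum_congr rfl fun i _ => by ring

theorem eq_zero_of_mem_coneLayer_zero {ι κ : Type*} [Fintype κ] {g : κ → ι → ℤ} {x : ι → ℤ}
    (hx : x ∈ coneLayer g 0) : x = 0 := by
  obtain ⟨w, h1, h2, h3⟩ := hx
  have hw : ∀ i, w i = 0 := fun i =>
    (Finset.sum_eq_zero_iff_of_nonneg fun i _ => h1 i).1 (by simpa using h2) i
      (Finset.mem_univ i)
  ext k
  have := h3 k
  simpa [hw] using this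

theorem latticeCount_latticePolytope {ι κ : Type*} [Fintype κ] [Nonempty κ] (g : κ → ι → ℤ)
    (t : ℕ) : latticeCount (latticePolytope g) t = (coneLayer g t).ncard := by
  classical
  rw [latticeCount]
  congr 1
  ext x
  constructor
  · rintro ⟨p, hp, hx⟩
    obtain ⟨w, h1, h2, h3⟩ := (mem_latticePolytope_iff g p).1 hp
    refine ⟨fun i => t * w i, fun i => mul_nonneg t.cast_nonneg (h1 i), ?_, fun k => ?_⟩
    · rw [← Finset.mul_sum, h2, mul_one]
    · rw [hx, h3, Finset.mul_sum]
      exact Finset.sum_congr rfl fun i _ => (mul_assoc _ _ _).symm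
  · intro hx
    rcases Nat.eq_zero_or_pos t with rfl | ht
    · obtain ⟨i⟩ := ‹Nonempty κ›
      refine ⟨_, subset_convexHull ℝ _ ⟨i, rfl⟩, fun k => ?_⟩
      simp [eq_zero_of_mem_coneLayer_zero hx]
    · exact ⟨_, div_mem_of_mem_coneLayer ht hx, fun k => by field_simp⟩

/-- The lattice point count at `t = 0` is `1`, so it agrees with the constant term that is
prescribed for the Ehrhart series. -/
theorem ncard_coneLayer_zero {ι κ : Type*} [Fintype κ] (g : κ → ι → ℤ) :
    (coneLayer g 0).ncard = 1 := by
  rw [Set.ncard_eq_one]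
  refine ⟨0, Set.Subset.antisymm (fun x hx => eq_zero_of_mem_coneLayer_zero hx) ?_⟩
  rintro x rfl
  exact ⟨0, by simp, by simp, by simp⟩

theorem coeff_ehrhartSeries_latticePolytope {ι κ : Type*} [Fintype κ] [Nonempty κ]
    (g : κ → ι → ℤ) (t : ℕ) :
    PowerSeries.coeff t (ehrhartSeries (latticePolytope g)) = ((coneLayer g t).ncard : ℤ) := by
  rw [ehrhartSeries, PowerSeries.coeff_mk]
  split_ifs with h
  · rw [h, ncard_coneLayer_zero, Nat.cast_one]
  · rw [latticeCount_latticePolytope]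

theorem sum_of_mem_coneLayer {ι κ : Type*} [Fintype ι] [Fintype κ] {g : κ → ι → ℤ}
    (hg : ∀ i, ∑ k, g i k = 1) {t : ℕ} {x : ι → ℤ} (hx : x ∈ coneLayer g t) :
    ∑ k, x k = t := by
  obtain ⟨w, -, h2, h3⟩ := hx
  have : ((∑ k, x k : ℤ) : ℝ) = t := by
    push_cast
    simp_rw [h3]
    rw [Finset.sum_comm, ← h2]
    refine Finset.sum_congr rfl fun i _ => ?_
    rw [← Finset.mul_sum]
    have : (∑ k, (g i k : ℝ)) = 1 := by exact_mod_cast hg i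
    rw [this, mul_one]
  exact_mod_cast this

theorem abs_le_of_mem_coneLayer {ι κ : Type*} [Fintype κ] {g : κ → ι → ℤ} {M : ℕ}
    (hM : ∀ i k, |g i k| ≤ M) {t : ℕ} {x : ι → ℤ} (hx : x ∈ coneLayer g t) (k : ι) :
    |x k| ≤ M * t := by
  obtain ⟨w, h1, h2, h3⟩ := hx
  have : ((|x k| : ℤ) : ℝ) ≤ M * t := by
    rw [Int.cast_abs, h3, ← h2, Finset.mul_sum]
    refine (Finset.abs_sum_le_sum_abs _ _).trans (Finset.sum_le_sum fun i _ => ?_)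
    rw [abs_mul, abs_of_nonneg (h1 i), mul_comm]
    have : |(g i k : ℝ)| ≤ M := by exact_mod_cast hM i k
    exact mul_le_mul_of_nonneg_right this (h1 i)
  exact_mod_cast this

theorem exists_abs_le {ι κ : Type*} [Fintype ι] [Fintype κ] (g : κ → ι → ℤ) :
    ∃ M : ℕ, ∀ i k, |g i k| ≤ M := by
  refine ⟨∑ i, ∑ k, (g i k).natAbs, fun i k => ?_⟩
  rw [← Int.natCast_natAbs]
  norm_cast
  exact (Finset.single_le_sum (f := fun k => (g i k).natAbs) (fun _ _ => Nat.zero_le _)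
    (Finset.mem_univ k)).trans
    (Finset.single_le_sum (f := fun i => ∑ k, (g i k).natAbs) (fun _ _ => Nat.zero_le _)
      (Finset.mem_univ i))

theorem finite_coneLayer {ι κ : Type*} [Fintype ι] [Fintype κ] (g : κ → ι → ℤ) (t : ℕ) :
    (coneLayer g t).Finite := by
  classical
  obtain ⟨M, hM⟩ := exists_abs_le g
  refine (Set.finite_Icc (fun _ : ι => -(M * t : ℤ)) fun _ => (M * t : ℤ)).subset fun x hx => ?_
  exact ⟨fun k => (abs_le.1 (abs_le_of_mem_coneLayer hM hx k)).1,
    fun k => (abs_le.1 (abs_le_of_mem_coneLayer hM hx k)).2⟩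

/-- The layers grow at most like `t ^ (n - 1)`: a point is determined by all but one of its
coordinates, and these are linearly bounded in `t`. -/
theorem ncard_coneLayer_le {ι κ : Type*} [Fintype ι] [Nonempty ι] [Fintype κ] (g : κ → ι → ℤ)
    (hg : ∀ i, ∑ k, g i k = 1) :
    ∃ C : ℕ, ∀ t, (coneLayer g t).ncard ≤ C * (t + 1) ^ (Fintype.card ι - 1) := by
  classical
  obtain ⟨M, hM⟩ := exists_abs_le g
  obtain ⟨k₀⟩ := ‹Nonempty ι›
  refine ⟨(2 * M + 1) ^ (Fintype.card ι - 1), fun t => ?_⟩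
  set B : Finset ({k // k ≠ k₀} → ℤ) := Fintype.piFinset fun _ => Finset.Icc (-(M * t : ℤ)) (M * t)
  have hB : B.card = (2 * M * t + 1) ^ (Fintype.card ι - 1) := by
    rw [Fintype.card_piFinset, Finset.prod_const, Int.card_Icc, Finset.card_univ,
      Fintype.card_subtype_compl, Fintype.card_subtype_eq]
    congr 1
    zify
    have h0 : (0 : ℤ) ≤ M * t := by positivity
    rw [Int.toNat_of_nonneg (by linarith)]
    ring
  have hle : (coneLayer g t).ncard ≤ (B : Set ({k // k ≠ k₀} → ℤ)).ncard := by
    refine Set.ncard_le_ncard_of_injOn (fun x k => x k) ?_ ?_ B.finite_toSet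
    · intro x hx
      simp only [B, Finset.mem_coe, Fintype.mem_piFinset, Finset.mem_Icc]
      exact fun k => abs_le.1 (abs_le_of_mem_coneLayer hM hx k)
    · intro x hx y hy hxy
      have hne : ∀ k, k ≠ k₀ → x k = y k := fun k hk => congrFun hxy ⟨k, hk⟩
      have hsum := (sum_of_mem_coneLayer hg hx).trans (sum_of_mem_coneLayer hg hy).symm
      rw [← Finset.add_sum_erase _ _ (Finset.mem_univ k₀),
        ← Finset.add_sum_erase _ y (Finset.mem_univ k₀),
        Finset.sum_congr rfl fun k hk => hne k (Finset.ne_of_mem_erase hk)] at hsum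
      ext k
      by_cases hk : k = k₀
      · subst hk; exact add_right_cancel hsum
      · exact hne k hk
  rw [Set.ncard_coe_finset, hB] at hle
  refine hle.trans ?_
  rw [← mul_pow]
  apply Nat.pow_le_pow_left
  nlinarith [Nat.zero_le M, Nat.zero_le t]

/-- The integer point `β j + ∑ i, a i • g i`. -/
def rep {ι : Type*} {m r : ℕ} (g : Fin m → ι → ℤ) (β : Fin r → ι → ℤ) (j : Fin r)
    (a : Fin m → ℕ) : ι → ℤ := fun k => β j k + ∑ i, (a i : ℤ) * g i k

/-- The exponents `a` for which `(j, a)` is, lexicographically, the least representation of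
`β j + ∑ i, a i • g i`. Translating a smaller representation keeps it smaller, so this is a
lower set. -/
noncomputable def minimalReps {ι : Type*} {m r : ℕ} (g : Fin m → ι → ℤ) (β : Fin r → ι → ℤ)
    (j : Fin r) : LowerSet (Fin m → ℕ) where
  carrier := {a | ∀ j' a', rep g β j' a' = rep g β j a →
    (toLex (j, toLex a) : Fin r ×ₗ Lex (Fin m → ℕ)) ≤ toLex (j', toLex a')}
  lower' := by
    intro a b hba ha j' b' hb'
    obtain ⟨c, rfl⟩ := exists_add_of_le hba
    have h := ha j' (b' + c) (by
      have h1 : ∀ (j : Fin r) (b : Fin m → ℕ), rep g β j (b + c) =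
          fun k => rep g β j b k + ∑ i, (c i : ℤ) * g i k := by
        intro j b
        ext k
        simp only [rep, Pi.add_apply, Nat.cast_add, add_mul, Finset.sum_add_distrib]
        ring
      rw [h1, h1, hb'])
    rw [Prod.Lex.toLex_le_toLex] at h ⊢
    rcases h with h | ⟨h, h'⟩
    · exact Or.inl h
    · refine Or.inr ⟨h, ?_⟩
      simp only [toLex_add] at h'
      exact le_of_add_le_add_right h'

/-- **Rationality of the Ehrhart series** of a lattice polytope in the hyperplane of coordinate
sum `1`, with the expected bound on the pole order. -/
theorem hasPoleOrderLE_ehrhartSeries {ι : Type*} [Fintype ι] [Nonempty ι] {m : ℕ} [NeZero m]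
    (g : Fin m → ι → ℤ) (hg : ∀ i, ∑ k, g i k = 1) :
    HasPoleOrderLE (Fintype.card ι) (ehrhartSeries (latticePolytope g)) := by
  classical
  obtain ⟨C, hC⟩ := ncard_coneLayer_le g hg
  have hcard : Fintype.card ι - 1 + 1 = Fintype.card ι := Nat.sub_add_cancel Fintype.card_pos
  rw [← hcard]
  -- the decomposition below only gives a pole of order at most `m`; growth improves the bound
  refine HasPoleOrderLE.of_coeff_le (m := m) ?_ C fun t => ?_
  swap
  · rw [coeff_ehrhartSeries_latticePolytope, abs_of_nonneg (Int.natCast_nonneg _)]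
    exact_mod_cast hC t
  obtain ⟨M, hM⟩ := exists_abs_le g
  -- a finite set which contains all combinations of the generators with coefficients in `[0, 1)`
  set B : Set (ι → ℤ) := {x | ∃ d ≤ m, x ∈ coneLayer g d} with hB
  have hBfin : B.Finite := by
    have : B = ⋃ d ∈ Set.Iic m, coneLayer g d := by ext; simp [hB]
    rw [this]
    exact (Set.finite_Iic m).biUnion fun d _ => finite_coneLayer g d
  obtain ⟨r, ⟨e⟩⟩ : ∃ r, Nonempty (Fin r ≃ B) :=
    have := hBfin.to_subtype
    ⟨Nat.card B, ⟨(Finite.equivFin B).symm⟩⟩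
  set β : Fin r → ι → ℤ := fun j => e j with hβ
  have hβB : ∀ j, ∃ d ≤ m, β j ∈ coneLayer g d := fun j => (e j).2
  choose d hdm hd using hβB
  -- rounding down the weights splits off a nonnegative integer combination of the generators
  have hrep : ∀ t x, x ∈ coneLayer g t ↔ ∃ j a, ∑ i, a i + d j = t ∧ rep g β j a = x := by
    intro t x
    constructor
    · intro hx
      have hsumx := sum_of_mem_coneLayer hg hx
      obtain ⟨w, h1, h2, h3⟩ := hx
      set y : ι → ℤ := fun k => x k - ∑ i, (⌊w i⌋₊ : ℤ) * g i k with hy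
      have hy' : ∀ k, (y k : ℝ) = ∑ i, (w i - ⌊w i⌋₊) * g i k := by
        intro k
        simp only [hy]
        push_cast
        rw [h3, ← Finset.sum_sub_distrib]
        exact Finset.sum_congr rfl fun i _ => by ring
      have hle : ∑ i, ⌊w i⌋₊ ≤ t := by
        have : ((∑ i, ⌊w i⌋₊ : ℕ) : ℝ) ≤ t := by
          rw [← h2]; push_cast
          exact Finset.sum_le_sum fun i _ => Nat.floor_le (h1 i)
        exact_mod_cast this
      have hlay : y ∈ coneLayer g (t - ∑ i, ⌊w i⌋₊) := by
        refine ⟨fun i => w i - ⌊w i⌋₊, fun i => sub_nonneg.2 (Nat.floor_le (h1 i)), ?_, hy'⟩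
        rw [Nat.cast_sub hle, Finset.sum_sub_distrib, h2]
        push_cast
        rfl
      have hm : t - ∑ i, ⌊w i⌋₊ ≤ m := by
        have : ((t - ∑ i, ⌊w i⌋₊ : ℕ) : ℝ) ≤ m := by
          rw [Nat.cast_sub hle, ← h2]; push_cast
          rw [← Finset.sum_sub_distrib]
          calc ∑ i, (w i - ⌊w i⌋₊) ≤ ∑ i : Fin m, (1 : ℝ) :=
                Finset.sum_le_sum fun i _ => by linarith [Nat.lt_floor_add_one (w i)]
            _ = m := by simp
        exact_mod_cast this
      have hej : β (e.symm ⟨y, _, hm, hlay⟩) = y := by simp [hβ]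
      refine ⟨e.symm ⟨y, _, hm, hlay⟩, fun i => ⌊w i⌋₊, ?_, ?_⟩
      · have h4 := sum_of_mem_coneLayer hg (hd (e.symm ⟨y, _, hm, hlay⟩))
        rw [hej, sum_of_mem_coneLayer hg hlay] at h4
        have h5 : t - ∑ i, ⌊w i⌋₊ = d (e.symm ⟨y, _, hm, hlay⟩) := by exact_mod_cast h4
        show ∑ i, ⌊w i⌋₊ + _ = t
        omega
      · ext k
        rw [rep, hej]
        simp [hy]
    · rintro ⟨j, a, rfl, rfl⟩
      obtain ⟨w, h1, h2, h3⟩ := hd j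
      refine ⟨fun i => a i + w i, fun i => add_nonneg (Nat.cast_nonneg _) (h1 i), ?_, fun k => ?_⟩
      · rw [Finset.sum_add_distrib, h2]; push_cast; rfl
      · simp only [rep]
        push_cast
        rw [h3, ← Finset.sum_add_distrib]
        exact Finset.sum_congr rfl fun i _ => by ring
  have hsumrep : ∀ j a, ∑ k, rep g β j a k = ((∑ i, a i + d j : ℕ) : ℤ) := fun j a =>
    sum_of_mem_coneLayer hg ((hrep _ _).2 ⟨j, a, rfl, rfl⟩)
  -- every point has a unique lexicographically least representation
  have hser : ehrhartSeries (latticePolytope g) =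
      ∑ j, PowerSeries.X ^ d j * sumSeries (minimalReps g β j : Set (Fin m → ℕ)) := by
    ext t
    rw [coeff_ehrhartSeries_latticePolytope, map_sum]
    have hunion : coneLayer g t = ⋃ j, rep g β j ''
        {a | a ∈ (minimalReps g β j : Set (Fin m → ℕ)) ∧ ∑ i, a i + d j = t} := by
      ext x
      simp only [Set.mem_iUnion, Set.mem_image]
      constructor
      · intro hx
        obtain ⟨j₀, a₀, -, h₀⟩ := (hrep t x).1 hx
        obtain ⟨q, hq, hmin⟩ := WellFounded.has_min
          (wellFounded_lt (α := Fin r ×ₗ Lex (Fin m → ℕ)))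
          {q | rep g β (ofLex q).1 (ofLex (ofLex q).2) = x} ⟨toLex (j₀, toLex a₀), h₀⟩
        refine ⟨(ofLex q).1, ofLex (ofLex q).2, ⟨?_, ?_⟩, hq⟩
        · intro j' a' h'
          refine not_lt.1 (hmin (toLex (j', toLex a')) ?_)
          exact h'.trans hq
        · have h6 := hsumrep (ofLex q).1 (ofLex (ofLex q).2)
          rw [show rep g β (ofLex q).1 (ofLex (ofLex q).2) = x from hq,
            sum_of_mem_coneLayer hg hx] at h6
          exact_mod_cast h6.symm
      · rintro ⟨j, a, ⟨-, h⟩, rfl⟩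
        exact (hrep _ _).2 ⟨j, a, h, rfl⟩
    have hfin : ∀ j, {a | a ∈ (minimalReps g β j : Set (Fin m → ℕ)) ∧
        ∑ i, a i + d j = t}.Finite := fun j =>
      (finite_setOf_sum_eq m (t - d j)).subset fun a ha => Nat.eq_sub_of_add_eq ha.2
    rw [hunion, Set.ncard_iUnion_of_finite (fun j => (hfin j).image _), finsum_eq_sum_of_fintype,
      Nat.cast_sum]
    · refine Finset.sum_congr rfl fun j _ => ?_
      rw [PowerSeries.coeff_X_pow_mul', Set.InjOn.ncard_image]
      · split_ifs with h
        · rw [sumSeries, PowerSeries.coeff_mk]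
          congr 2
          ext a
          have : ∑ i, a i + d j = t ↔ ∑ i, a i = t - d j := by omega
          exact and_congr_right fun _ => this
        · rw [Nat.cast_eq_zero, Set.ncard_eq_zero (hfin j)]
          ext a
          simp only [Set.mem_ofPred_eq, Set.mem_empty_iff_false, iff_false, not_and]
          intro _ h'
          omega
      · intro a ha b hb hab
        have h7 := le_antisymm (ha.1 j b hab.symm) (hb.1 j a hab)
        simpa using h7
    · intro j j' hjj'
      rw [Function.onFun, Set.disjoint_left]
      rintro x ⟨a, ha, rfl⟩ ⟨b, hb, hab⟩
      have h7 := le_antisymm (ha.1 j' b hab) (hb.1 j a hab.symm)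
      simp only [EmbeddingLike.apply_eq_iff_eq, Prod.mk.injEq] at h7
      exact hjj' h7.1
  rw [hser]
  exact HasPoleOrderLE.sum _ _ fun j _ => (hasPoleOrderLE_sumSeries _).X_pow_mul _

/-! ### Cut inequalities for the cosmological polytope -/

open scoped Classical in
/-- The three generators attached to the edge `f` with ends `s f` and `t f`. In the generator
`(f, k)` the sign is negative at `f`, `t f`, `s f` for `k = 0, 1, 2`. -/
noncomputable def edgeGen {V E : Type*} (s t : E → V) (q : E × Fin 3) : V ⊕ E → ℤ :=
  (if q.2 = 2 then -1 else 1 : ℤ) • Pi.single (Sum.inl (s q.1)) 1 +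
    (if q.2 = 1 then -1 else 1 : ℤ) • Pi.single (Sum.inl (t q.1)) 1 +
    (if q.2 = 0 then -1 else 1 : ℤ) • Pi.single (Sum.inr q.1) 1

/-- For nonnegative vertex weights `c`, the minimum of `∑ i, c i * x i + ∑ f, a f * x f` over the
edge weights `a` which satisfy the triangle inequalities `|c i - c j| ≤ a f ≤ c i + c j` for all
edges `f = ij`. These inequalities say that `(c, a)` is nonnegative on the generators. -/
def cutValue {V E R : Type*} [Fintype V] [Fintype E] [CommRing R] [LinearOrder R]
    (s t : E → V) (x : V ⊕ E → R) (c : V → R) : R :=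
  ∑ i, c i * x (Sum.inl i) +
    ∑ f, min (x (Sum.inr f) * |c (s f) - c (t f)|) (x (Sum.inr f) * (c (s f) + c (t f)))

section

variable {V E : Type*} [Fintype V] [Fintype E] (s t : E → V)

theorem sum_mul_edgeGen (a : V ⊕ E → ℝ) (q : E × Fin 3) :
    ∑ k, a k * (edgeGen s t q k : ℝ) =
      (if q.2 = 2 then -1 else 1) * a (Sum.inl (s q.1)) +
      (if q.2 = 1 then -1 else 1) * a (Sum.inl (t q.1)) +
      (if q.2 = 0 then -1 else 1) * a (Sum.inr q.1) := by
  classical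
  have h : ∀ (k k' : V ⊕ E) (z : ℤ), a k * ((z * (Pi.single k' (1 : ℤ) : V ⊕ E → ℤ) k : ℤ) : ℝ) =
      if k = k' then z * a k else 0 := by
    intro k k' z
    rcases eq_or_ne k k' with rfl | hk
    · simp [mul_comm]
    · simp [hk]
  simp only [edgeGen, Pi.add_apply, Pi.smul_apply, smul_eq_mul, Int.cast_add, mul_add,
    Finset.sum_add_distrib]
  have h' : ∀ (k' : V ⊕ E) (z : ℤ),
      ∑ k, a k * ((z * (Pi.single k' (1 : ℤ) : V ⊕ E → ℤ) k : ℤ) : ℝ) = z * a k' := by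
    intro k' z
    simp_rw [h]
    simp
  rw [h', h', h']
  push_cast
  rfl

theorem sum_edgeGen (q : E × Fin 3) : ∑ k, edgeGen s t q k = 1 := by
  have h := sum_mul_edgeGen s t (fun _ => 1) q
  have h' : ((∑ k, edgeGen s t q k : ℤ) : ℝ) = 1 := by
    push_cast
    simp only [one_mul] at h
    rw [h]
    obtain ⟨f, k⟩ := q
    obtain rfl | rfl | rfl : k = 0 ∨ k = 1 ∨ k = 2 := by fin_cases k <;> simp
    all_goals simp
  exact_mod_cast h'

theorem cutValue_intCast (x : V ⊕ E → ℤ) (c : V → ℤ) :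
    cutValue s t (fun k => (x k : ℝ)) (fun i => (c i : ℝ)) = ((cutValue s t x c : ℤ) : ℝ) := by
  simp only [cutValue]
  push_cast
  rfl

variable {s t}

theorem cutValue_nonneg_of_mem_coneLayer {T : ℕ} {x : V ⊕ E → ℤ}
    (hx : x ∈ coneLayer (edgeGen s t) T) {c : V → ℝ} (hc : ∀ i, 0 ≤ c i) :
    0 ≤ cutValue s t (fun k => (x k : ℝ)) c := by
  obtain ⟨w, h1, -, h3⟩ := hx
  set a : V ⊕ E → ℝ := Sum.elim c fun f =>
    if 0 ≤ x (Sum.inr f) then |c (s f) - c (t f)| else c (s f) + c (t f) with ha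
  have htri : ∀ f, |c (s f) - c (t f)| ≤ c (s f) + c (t f) := fun f =>
    abs_le.2 ⟨by linarith [hc (s f)], by linarith [hc (t f)]⟩
  have ha1 : ∀ f, |c (s f) - c (t f)| ≤ a (Sum.inr f) := by
    intro f
    simp only [ha, Sum.elim_inr]
    split_ifs
    · exact le_rfl
    · exact htri f
  have ha2 : ∀ f, a (Sum.inr f) ≤ c (s f) + c (t f) := by
    intro f
    simp only [ha, Sum.elim_inr]
    split_ifs
    · exact htri f
    · exact le_rfl
  have hcut : cutValue s t (fun k => (x k : ℝ)) c = ∑ k, a k * (x k : ℝ) := by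
    rw [cutValue, Fintype.sum_sum_type]
    congr 1
    refine Finset.sum_congr rfl fun f _ => ?_
    simp only [ha, Sum.elim_inr]
    split_ifs with h
    · have h' : (0 : ℝ) ≤ x (Sum.inr f) := by exact_mod_cast h
      rw [min_eq_left (mul_le_mul_of_nonneg_left (htri f) h'), mul_comm]
    · have h' : (x (Sum.inr f) : ℝ) ≤ 0 := by exact_mod_cast (not_le.1 h).le
      rw [min_eq_right (mul_le_mul_of_nonpos_left (htri f) h'), mul_comm]
  rw [hcut]
  simp_rw [h3, Finset.mul_sum]
  rw [Finset.sum_comm]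
  refine Finset.sum_nonneg fun q _ => ?_
  have h4 : ∑ k, a k * (w q * (edgeGen s t q k : ℝ)) = w q * ∑ k, a k * (edgeGen s t q k : ℝ) := by
    rw [Finset.mul_sum]
    exact Finset.sum_congr rfl fun k _ => by ring
  rw [h4, sum_mul_edgeGen]
  refine mul_nonneg (h1 q) ?_
  obtain ⟨f, k⟩ := q
  have h5 := abs_le.1 (ha1 f)
  have h6 := ha2 f
  have h7 : a (Sum.inl (s f)) = c (s f) := rfl
  have h8 : a (Sum.inl (t f)) = c (t f) := rfl
  fin_cases k <;> simp [h7, h8] <;> linarith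

theorem add_cutValue_le (x : V ⊕ E → ℝ) {m : ℝ} (hm : 0 ≤ m) (a b c : V → ℝ)
    (hsum : ∀ i, a i = m * c i + b i)
    (habs : ∀ i j, |a i - a j| = m * |c i - c j| + |b i - b j|) :
    m * cutValue s t x c + cutValue s t x b ≤ cutValue s t x a := by
  simp only [cutValue, mul_add, Finset.mul_sum]
  rw [add_add_add_comm, ← Finset.sum_add_distrib, ← Finset.sum_add_distrib]
  refine add_le_add (le_of_eq (Finset.sum_congr rfl fun i _ => by rw [hsum]; ring))
    (Finset.sum_le_sum fun f _ => ?_)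
  rw [habs, hsum, hsum, mul_min_of_nonneg _ _ hm]
  refine min_add_min_le_min_add_add.trans (le_of_eq ?_)
  congr 1 <;> ring

/-- It suffices to test the cut inequalities on indicator functions: a nonnegative weight function
is a nonnegative combination of the indicator functions of its level sets, and on such a
combination of nested sets the cut value is superadditive. -/
theorem cutValue_nonneg_of_indicator {x : V ⊕ E → ℝ}
    (hx : ∀ c : V → ℝ, (∀ i, c i = 0 ∨ c i = 1) → 0 ≤ cutValue s t x c) :
    ∀ a : V → ℝ, (∀ i, 0 ≤ a i) → 0 ≤ cutValue s t x a := by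
  classical
  suffices h : ∀ n, ∀ a : V → ℝ, (∀ i, 0 ≤ a i) → {i | a i ≠ 0}.ncard = n →
      0 ≤ cutValue s t x a from fun a ha => h _ a ha rfl
  intro n
  induction n using Nat.strong_induction_on with
  | _ n ih =>
    intro a ha hn
    by_cases hzero : ∀ i, a i = 0
    · exact hx a fun i => Or.inl (hzero i)
    push Not at hzero
    obtain ⟨i₁, hi₁⟩ := hzero
    -- subtract the least nonzero value on the whole support
    obtain ⟨i₀, hi₀, hmin⟩ := Set.exists_min_image {i | a i ≠ 0} a (Set.toFinite _) ⟨i₁, hi₁⟩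
    set c : V → ℝ := fun i => if a i = 0 then 0 else 1 with hc
    set b : V → ℝ := fun i => a i - a i₀ * c i with hb
    have hbnn : ∀ i, 0 ≤ b i := by
      intro i
      simp only [hb, hc]
      split_ifs with h
      · simp [h]
      · simpa using hmin i h
    have hcard : {i | b i ≠ 0}.ncard < n := by
      rw [← hn]
      refine Set.ncard_lt_ncard ⟨?_, ?_⟩ (Set.toFinite _)
      · intro i hi h0
        exact hi (by simp [hb, hc, h0])
      · intro hsub
        exact hsub hi₀ (by simp [hb, hc, show a i₀ ≠ 0 from hi₀])
    have hm : 0 ≤ a i₀ := ha i₀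
    have hle := add_cutValue_le (s := s) (t := t) x hm a b c (fun i => by simp [hb]) (by
      intro i j
      simp only [hb, hc]
      split_ifs with h h' h'
      · simp [h, h']
      · have := hmin j h'
        simp only [h]
        rw [abs_of_nonpos (by linarith [ha j]),
          abs_of_nonpos (by linarith : (0 - a i₀ * 0 - (a j - a i₀ * 1) : ℝ) ≤ 0)]
        norm_num
      · have := hmin i h
        simp only [h']
        rw [abs_of_nonneg (by linarith [ha i]),
          abs_of_nonneg (by linarith : (0 : ℝ) ≤ a i - a i₀ * 1 - (0 - a i₀ * 0))]
        norm_num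
      · simp)
    have h1 : 0 ≤ cutValue s t x c := hx c fun i => by
      simp only [hc]; split_ifs <;> simp
    have h2 := ih _ hcard b hbnn rfl
    have := mul_nonneg hm h1
    linarith

/-- A functional separating `x` from the polytope is, up to a multiple of the coordinate sum,
nonnegative on the generators, that is, its edge weights satisfy the triangle inequalities. -/
theorem mem_coneLayer_of_cutValue_nonneg (hinc : ∀ i, ∃ f, s f = i ∨ t f = i) {T : ℕ} (hT : 0 < T)
    {x : V ⊕ E → ℤ} (hsum : ∑ k, x k = T)
    (hcut : ∀ c : V → ℝ, (∀ i, 0 ≤ c i) → 0 ≤ cutValue s t (fun k => (x k : ℝ)) c) :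
    x ∈ coneLayer (edgeGen s t) T := by
  classical
  have hT' : (0 : ℝ) < T := by exact_mod_cast hT
  apply mem_coneLayer_of_div_mem hT
  by_contra hx
  obtain ⟨ℓ, u, hℓ1, hℓ2⟩ := geometric_hahn_banach_point_closed (convex_convexHull ℝ _)
    ((Set.finite_range _).isCompact_convexHull ℝ).isClosed hx
  set a : V ⊕ E → ℝ := fun k => ℓ (Pi.single k 1) - u with ha
  have hℓ : ∀ y : V ⊕ E → ℝ, ∑ k, a k * y k = ℓ y - u * ∑ k, y k := by
    intro y
    have h1 : ℓ y = ∑ k, y k * ℓ (Pi.single k 1) := by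
      conv_lhs => rw [pi_eq_sum_univ' y]
      simp [map_sum]
    rw [h1, Finset.mul_sum, ← Finset.sum_sub_distrib]
    exact Finset.sum_congr rfl fun k _ => by simp only [ha]; ring
  have hgen : ∀ q, 0 ≤ ∑ k, a k * (edgeGen s t q k : ℝ) := by
    intro q
    rw [hℓ fun k => (edgeGen s t q k : ℝ)]
    have h1 := hℓ2 _ (subset_convexHull ℝ _ ⟨q, rfl⟩)
    have h2 : (∑ k, (edgeGen s t q k : ℝ)) = 1 := by exact_mod_cast sum_edgeGen s t q
    rw [h2]
    linarith
  have hneg : ∑ k, a k * (x k : ℝ) < 0 := by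
    rw [hℓ fun k => (x k : ℝ)]
    have h2 : (∑ k, (x k : ℝ)) = T := by exact_mod_cast hsum
    have h3 : (fun k => (x k : ℝ) / T) = (T : ℝ)⁻¹ • fun k => (x k : ℝ) := by
      ext k; simp [div_eq_inv_mul]
    rw [h3, map_smul, smul_eq_mul, inv_mul_lt_iff₀ hT'] at hℓ1
    rw [h2]
    linarith
  have h0 : ∀ f, a (Sum.inr f) ≤ a (Sum.inl (s f)) + a (Sum.inl (t f)) := by
    intro f
    have := hgen (f, 0)
    rw [sum_mul_edgeGen] at this
    simp at this
    linarith
  have h1 : ∀ f, a (Sum.inl (t f)) ≤ a (Sum.inl (s f)) + a (Sum.inr f) := by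
    intro f
    have := hgen (f, 1)
    rw [sum_mul_edgeGen] at this
    simp at this
    linarith
  have h2 : ∀ f, a (Sum.inl (s f)) ≤ a (Sum.inl (t f)) + a (Sum.inr f) := by
    intro f
    have := hgen (f, 2)
    rw [sum_mul_edgeGen] at this
    simp at this
    linarith
  have hnn : ∀ i, 0 ≤ a (Sum.inl i) := by
    intro i
    obtain ⟨f, rfl | rfl⟩ := hinc i
    · linarith [h0 f, h1 f]
    · linarith [h0 f, h2 f]
  refine absurd (hcut (fun i => a (Sum.inl i)) hnn) (not_le.2 (lt_of_le_of_lt ?_ hneg))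
  rw [cutValue, Fintype.sum_sum_type]
  refine add_le_add le_rfl (Finset.sum_le_sum fun f _ => ?_)
  rcases le_total 0 (x (Sum.inr f)) with h | h
  · have h' : (0 : ℝ) ≤ x (Sum.inr f) := by exact_mod_cast h
    refine (min_le_left _ _).trans ?_
    rw [mul_comm (a _)]
    exact mul_le_mul_of_nonneg_left (abs_le.2 ⟨by linarith [h1 f], by linarith [h2 f]⟩) h'
  · have h' : (x (Sum.inr f) : ℝ) ≤ 0 := by exact_mod_cast h
    refine (min_le_right _ _).trans ?_
    rw [mul_comm (a _)]
    exact mul_le_mul_of_nonpos_left (h0 f) h'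

variable (s t) in
/-- The integer points all of whose cuts have nonnegative value. -/
def cutPoints : Set (V ⊕ E → ℤ) :=
  {x | ∀ c : V → ℤ, (∀ i, c i = 0 ∨ c i = 1) → 0 ≤ cutValue s t x c}

/-- The full cut bounds the coordinate sum below by `∑ f, |x f|`; if the sum vanishes, the
singletons show that the vertex coordinates are nonnegative, so they vanish too. -/
theorem sum_nonneg_of_mem_cutPoints {x : V ⊕ E → ℤ} (hx : x ∈ cutPoints s t) :
    0 ≤ ∑ k, x k ∧ (∑ k, x k = 0 → x = 0) := by
  classical
  have h1 := hx (fun _ => 1) fun _ => Or.inr rfl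
  have h2 : cutValue s t x (fun _ => 1) ≤ ∑ k, x k - ∑ f, |x (Sum.inr f)| := by
    rw [cutValue, Fintype.sum_sum_type, add_sub_assoc, ← Finset.sum_sub_distrib]
    refine add_le_add (by simp) (Finset.sum_le_sum fun f _ => ?_)
    simp only [sub_self, abs_zero, mul_zero]
    rcases le_total 0 (x (Sum.inr f)) with h | h
    · rw [abs_of_nonneg h]; exact (min_le_left _ _).trans (by simp)
    · rw [abs_of_nonpos h]; exact (min_le_right _ _).trans (by linarith)
  have h3 : 0 ≤ ∑ f, |x (Sum.inr f)| := Finset.sum_nonneg fun _ _ => abs_nonneg _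
  refine ⟨by linarith, fun h0 => ?_⟩
  have hE : ∀ f, x (Sum.inr f) = 0 := by
    have h4 : ∑ f, |x (Sum.inr f)| = 0 := by linarith
    intro f
    exact abs_eq_zero.1
      ((Finset.sum_eq_zero_iff_of_nonneg fun _ _ => abs_nonneg _).1 h4 f (Finset.mem_univ f))
  have hV : ∀ i, 0 ≤ x (Sum.inl i) := by
    intro i
    have := hx (Pi.single i 1) fun j => by
      rcases eq_or_ne j i with rfl | h
      · simp
      · simp [h]
    simpa [cutValue, hE, Pi.single_apply] using this
  have hV0 : ∀ i, x (Sum.inl i) = 0 := by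
    rw [Fintype.sum_sum_type] at h0
    simp only [hE, Finset.sum_const_zero, add_zero] at h0
    intro i
    exact (Finset.sum_eq_zero_iff_of_nonneg fun i _ => hV i).1 h0 i (Finset.mem_univ i)
  ext (i | f)
  · exact hV0 i
  · exact hE f

/-- The integer points of the `T`-th dilate are the points of coordinate sum `T` which satisfy all
cut inequalities. -/
theorem mem_coneLayer_edgeGen_iff (hinc : ∀ i, ∃ f, s f = i ∨ t f = i) {T : ℕ}
    {x : V ⊕ E → ℤ} :
    x ∈ coneLayer (edgeGen s t) T ↔ x ∈ cutPoints s t ∧ ∑ k, x k = T := by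
  constructor
  · intro hx
    refine ⟨fun c hc => ?_, sum_of_mem_coneLayer (sum_edgeGen s t) hx⟩
    have h := cutValue_nonneg_of_mem_coneLayer hx (c := fun i => (c i : ℝ)) fun i => by
      rcases hc i with h | h <;> simp [h]
    rw [cutValue_intCast] at h
    exact_mod_cast h
  · rintro ⟨hx, hsum⟩
    rcases Nat.eq_zero_or_pos T with rfl | hT
    · rw [(sum_nonneg_of_mem_cutPoints hx).2 (by simpa using hsum)]
      exact ⟨0, by simp, by simp, by simp⟩
    refine mem_coneLayer_of_cutValue_nonneg hinc hT hsum (cutValue_nonneg_of_indicator ?_)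
    intro c hc
    have hc' : ∃ c' : V → ℤ, (∀ i, c' i = 0 ∨ c' i = 1) ∧ c = fun i => (c' i : ℝ) := by
      have : ∀ i, ∃ z : ℤ, (z = 0 ∨ z = 1) ∧ c i = (z : ℝ) := by
        intro i
        rcases hc i with h | h
        · exact ⟨0, Or.inl rfl, by simp [h]⟩
        · exact ⟨1, Or.inr rfl, by simp [h]⟩
      choose c' h1 h2 using this
      exact ⟨c', h1, funext h2⟩
    obtain ⟨c', h1, rfl⟩ := hc'
    rw [cutValue_intCast]
    exact_mod_cast hx c' h1

end

/-! ### Lattice points of a graph glued at a vertex -/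

section

variable {V E : Type*} [Fintype V] [Fintype E]

/-- The points of `cutPoints s t` with coordinate sum `n`. -/
def cutLayer (s t : E → V) (n : ℕ) : Set (V ⊕ E → ℤ) := {x | x ∈ cutPoints s t ∧ ∑ k, x k = n}

/-- The generating function, by coordinate sum, of the points of `cutPoints s t`. -/
noncomputable def cutSeries (s t : E → V) : PowerSeries ℤ :=
  PowerSeries.mk fun n => ((cutLayer s t n).ncard : ℤ)

open scoped Classical in
/-- The points of `cutLayer s t n` whose coordinate at the vertex `v` cannot be lowered. -/
def minimalLayer (s t : E → V) (v : V) (n : ℕ) : Set (V ⊕ E → ℤ) :=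
  {x | x ∈ cutLayer s t n ∧ x - Pi.single (Sum.inl v) 1 ∉ cutPoints s t}

variable {s t : E → V}

theorem finite_cutLayer (hinc : ∀ i, ∃ f, s f = i ∨ t f = i) (n : ℕ) :
    (cutLayer s t n).Finite :=
  (finite_coneLayer (edgeGen s t) n).subset fun _ hx => (mem_coneLayer_edgeGen_iff hinc).2 hx

open scoped Classical in
theorem cutValue_add_single (x : V ⊕ E → ℤ) (v : V) (n : ℤ) (c : V → ℤ) :
    cutValue s t (x + Pi.single (Sum.inl v) n) c = cutValue s t x c + n * c v := by
  simp only [cutValue, Pi.add_apply, mul_add, Finset.sum_add_distrib]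
  simp [Pi.single_apply, mul_comm]
  ring

open scoped Classical in
theorem sum_add_single (x : V ⊕ E → ℤ) (v : V) (n : ℤ) :
    ∑ k, (x + Pi.single (Sum.inl v) n : V ⊕ E → ℤ) k = ∑ k, x k + n := by
  simp [Finset.sum_add_distrib]

open scoped Classical in
theorem add_single_mem_cutPoints {x : V ⊕ E → ℤ} (hx : x ∈ cutPoints s t) (v : V) {n : ℤ}
    (hn : 0 ≤ n) : x + Pi.single (Sum.inl v) n ∈ cutPoints s t := by
  intro c hc
  rw [cutValue_add_single]
  have h1 := hx c hc
  have h2 : 0 ≤ c v := by rcases hc v with h | h <;> simp [h]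
  positivity

/-- Every point of `cutPoints s t` is uniquely a minimal point plus a multiple of the unit vector
at `v`. -/
theorem mk_ncard_minimalLayer (hinc : ∀ i, ∃ f, s f = i ∨ t f = i) (v : V) :
    PowerSeries.mk (fun n => ((minimalLayer s t v n).ncard : ℤ)) =
      (1 - PowerSeries.X) * cutSeries s t := by
  classical
  rw [sub_mul, one_mul, eq_sub_iff_add_eq]
  ext n
  rw [map_add, PowerSeries.coeff_mk, cutSeries, PowerSeries.coeff_mk]
  set D : Set (V ⊕ E → ℤ) := {x | x ∈ cutLayer s t n ∧ x - Pi.single (Sum.inl v) 1 ∈ cutPoints s t}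
    with hD
  have hfin := finite_cutLayer hinc n
  have hunion : cutLayer s t n = minimalLayer s t v n ∪ D := by
    ext x
    simp only [minimalLayer, hD, Set.mem_union, Set.mem_ofPred_eq]
    tauto
  have hcard : (cutLayer s t n).ncard = (minimalLayer s t v n).ncard + D.ncard := by
    conv_lhs => rw [hunion]
    refine Set.ncard_union_eq ?_ (hfin.subset fun x hx => hx.1) (hfin.subset fun x hx => hx.1)
    rw [Set.disjoint_left]
    exact fun x hx hx' => hx.2 hx'.2
  rw [hcard, Nat.cast_add]
  congr 1
  cases n with
  | zero =>
    rw [PowerSeries.coeff_zero_X_mul]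
    symm
    rw [Nat.cast_eq_zero, Set.ncard_eq_zero (hfin.subset fun x hx => hx.1),
      Set.eq_empty_iff_forall_notMem]
    rintro x ⟨⟨-, h1⟩, h2⟩
    have h3 := (sum_nonneg_of_mem_cutPoints h2).1
    have h4 := sum_add_single (x - Pi.single (Sum.inl v) 1) v 1
    rw [sub_add_cancel, h1] at h4
    rw [Nat.cast_zero] at h4
    linarith
  | succ n =>
    rw [PowerSeries.coeff_succ_X_mul, PowerSeries.coeff_mk, Nat.cast_inj]
    refine Set.ncard_congr (fun x _ => x + Pi.single (Sum.inl v) 1) ?_ ?_ ?_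
    · rintro x ⟨h1, h2⟩
      refine ⟨⟨add_single_mem_cutPoints h1 v zero_le_one, ?_⟩, ?_⟩
      · rw [sum_add_single, h2]; push_cast; rfl
      · rwa [add_sub_cancel_right]
    · intro x y _ _ h
      exact add_right_cancel h
    · rintro x ⟨⟨h1, h2⟩, h3⟩
      refine ⟨x - Pi.single (Sum.inl v) 1, ⟨h3, ?_⟩, sub_add_cancel _ _⟩
      have h4 := sum_add_single (x - Pi.single (Sum.inl v) 1) v 1
      rw [sub_add_cancel, h2] at h4
      push_cast at h4
      linarith

end

section

variable {V₁ V₂ E₁ E₂ : Type*} (v : V₁) (w : V₂)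

open scoped Classical in
/-- The inclusion of the vertices of the second summand into those of the glued graph; the vertex
`w` goes to `v`. -/
noncomputable def glueVertex (j : V₂) : V₁ ⊕ {j : V₂ // j ≠ w} :=
  if h : j = w then Sum.inl v else Sum.inr ⟨j, h⟩

/-- The ends of the edges of the glued graph. -/
noncomputable def glueEnd (s₁ : E₁ → V₁) (s₂ : E₂ → V₂) : E₁ ⊕ E₂ → V₁ ⊕ {j : V₂ // j ≠ w} :=
  Sum.elim (fun f => Sum.inl (s₁ f)) fun f => glueVertex v w (s₂ f)

open scoped Classical in
/-- The sum of two points, where the coordinates at `v` and `w` are identified. -/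
noncomputable def gluePoint (a : V₁ ⊕ E₁ → ℤ) (b : V₂ ⊕ E₂ → ℤ) :
    (V₁ ⊕ {j : V₂ // j ≠ w}) ⊕ (E₁ ⊕ E₂) → ℤ :=
  Sum.elim
    (Sum.elim (fun i => a (Sum.inl i) + if i = v then b (Sum.inl w) else 0)
      fun j => b (Sum.inl j))
    (Sum.elim (fun f => a (Sum.inr f)) fun f => b (Sum.inr f))

variable {v w}

theorem sumElim_glueVertex {R : Type*} (c₁ : V₁ → R) (c₂ : V₂ → R) (h : c₁ v = c₂ w) (j : V₂) :
    Sum.elim c₁ (fun j : {j : V₂ // j ≠ w} => c₂ j) (glueVertex v w j) = c₂ j := by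
  classical
  rw [glueVertex]
  split_ifs with hj
  · rw [hj]; exact h
  · rfl

theorem glueVertex_self : glueVertex v w w = Sum.inl v := by simp [glueVertex]

theorem glueVertex_coe (j : {j : V₂ // j ≠ w}) : glueVertex v w j.1 = Sum.inr j := by
  simp [glueVertex, j.2]

theorem eq_of_gluePoint_eq {a a' : V₁ ⊕ E₁ → ℤ} {b b' : V₂ ⊕ E₂ → ℤ}
    (h : gluePoint v w a b = gluePoint v w a' b') (hv : a (Sum.inl v) = a' (Sum.inl v)) :
    a = a' ∧ b = b' := by
  classical
  have hw : b (Sum.inl w) = b' (Sum.inl w) := by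
    have := congrFun h (Sum.inl (Sum.inl v))
    simpa [gluePoint, hv] using this
  refine ⟨?_, ?_⟩
  · ext (i | f)
    · have := congrFun h (Sum.inl (Sum.inl i))
      simpa [gluePoint, hw] using this
    · exact congrFun h (Sum.inr (Sum.inl f))
  · ext (j | f)
    · rcases eq_or_ne j w with rfl | hj
      · exact hw
      · exact congrFun h (Sum.inl (Sum.inr ⟨j, hj⟩))
    · exact congrFun h (Sum.inr (Sum.inr f))

open scoped Classical in
theorem gluePoint_add_single (a : V₁ ⊕ E₁ → ℤ) (b : V₂ ⊕ E₂ → ℤ) (n : ℤ) :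
    gluePoint v w (a + Pi.single (Sum.inl v) n) b =
      gluePoint v w a (b + Pi.single (Sum.inl w) n) := by
  ext ((i | j) | (f | f))
  · rcases eq_or_ne i v with rfl | hi
    · simp [gluePoint]; ring
    · simp [gluePoint, hi]
  · simp [gluePoint, j.2]
  · simp [gluePoint]
  · simp [gluePoint]

theorem exists_gluePoint_eq (x : (V₁ ⊕ {j : V₂ // j ≠ w}) ⊕ (E₁ ⊕ E₂) → ℤ) :
    ∃ (a : V₁ ⊕ E₁ → ℤ) (b : V₂ ⊕ E₂ → ℤ), gluePoint v w a b = x := by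
  classical
  refine ⟨Sum.elim (fun i => x (Sum.inl (Sum.inl i))) fun f => x (Sum.inr (Sum.inl f)),
    Sum.elim (fun j => if h : j = w then 0 else x (Sum.inl (Sum.inr ⟨j, h⟩)))
      fun f => x (Sum.inr (Sum.inr f)), ?_⟩
  ext ((i | j) | (f | f))
  · simp [gluePoint]
  · simp [gluePoint, j.2]
  · simp [gluePoint]
  · simp [gluePoint]

variable [Fintype V₁] [Fintype V₂] [Fintype E₁] [Fintype E₂]

theorem sum_eq_add_sum_ne [Fintype {j : V₂ // j ≠ w}] (F : V₂ → ℤ) :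
    ∑ j, F j = F w + ∑ j : {j : V₂ // j ≠ w}, F j := by
  classical
  rw [← Finset.add_sum_erase _ _ (Finset.mem_univ w)]
  congr 1
  exact Finset.sum_subtype _ (by simp) _

variable [Fintype {j : V₂ // j ≠ w}]

theorem sum_gluePoint (a : V₁ ⊕ E₁ → ℤ) (b : V₂ ⊕ E₂ → ℤ) :
    ∑ k, gluePoint v w a b k = ∑ k, a k + ∑ k, b k := by
  classical
  simp only [Fintype.sum_sum_type, gluePoint, Sum.elim_inl, Sum.elim_inr, Finset.sum_add_distrib]
  rw [sum_eq_add_sum_ne (w := w) fun j => b (Sum.inl j)]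
  simp
  ring

variable {s₁ t₁ : E₁ → V₁} {s₂ t₂ : E₂ → V₂}

theorem cutValue_gluePoint (a : V₁ ⊕ E₁ → ℤ) (b : V₂ ⊕ E₂ → ℤ)
    (c : V₁ ⊕ {j : V₂ // j ≠ w} → ℤ) :
    cutValue (glueEnd v w s₁ s₂) (glueEnd v w t₁ t₂) (gluePoint v w a b) c =
      cutValue s₁ t₁ a (fun i => c (Sum.inl i)) +
        cutValue s₂ t₂ b (fun j => c (glueVertex v w j)) := by
  classical
  simp only [cutValue, Fintype.sum_sum_type, gluePoint, glueEnd, Sum.elim_inl, Sum.elim_inr,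
    mul_add, Finset.sum_add_distrib]
  rw [sum_eq_add_sum_ne (w := w) fun j => c (glueVertex v w j) * b (Sum.inl j)]
  simp only [glueVertex_self, glueVertex_coe]
  simp
  ring

theorem gluePoint_mem_cutPoints {a : V₁ ⊕ E₁ → ℤ} {b : V₂ ⊕ E₂ → ℤ} (ha : a ∈ cutPoints s₁ t₁)
    (hb : b ∈ cutPoints s₂ t₂) :
    gluePoint v w a b ∈ cutPoints (glueEnd v w s₁ s₂) (glueEnd v w t₁ t₂) := by
  intro c hc
  rw [cutValue_gluePoint]
  exact add_nonneg (ha _ fun i => hc _) (hb _ fun j => hc _)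

theorem cutValue_zero {V E : Type*} [Fintype V] [Fintype E] {s t : E → V} (x : V ⊕ E → ℤ) :
    cutValue s t x (fun _ => 0) = 0 := by
  simp [cutValue]

/-- If `a` is minimal at `v`, then some cut containing `v` is tight at `a`; combining it with the
cuts of the second summand which contain `w` shows that `b` satisfies all cut inequalities. -/
theorem mem_cutPoints_of_gluePoint_mem {a : V₁ ⊕ E₁ → ℤ} {b : V₂ ⊕ E₂ → ℤ}
    (hx : gluePoint v w a b ∈ cutPoints (glueEnd v w s₁ s₂) (glueEnd v w t₁ t₂))
    {c₁ : V₁ → ℤ} (hc₁ : ∀ i, c₁ i = 0 ∨ c₁ i = 1) (hv : c₁ v = 1)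
    (htight : cutValue s₁ t₁ a c₁ ≤ 0) : b ∈ cutPoints s₂ t₂ := by
  intro c₂ hc₂
  have key : ∀ c : V₁ → ℤ, (∀ i, c i = 0 ∨ c i = 1) → c v = c₂ w →
      0 ≤ cutValue s₁ t₁ a c + cutValue s₂ t₂ b c₂ := by
    intro c hc h
    have h1 := hx (Sum.elim c fun j => c₂ j) (by rintro (i | j); exacts [hc i, hc₂ j])
    rw [cutValue_gluePoint] at h1
    simpa [sumElim_glueVertex c c₂ h] using h1
  rcases hc₂ w with h | h
  · have := key (fun _ => 0) (fun _ => Or.inl rfl) h.symm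
    rwa [cutValue_zero, zero_add] at this
  · have := key c₁ hc₁ (hv.trans h.symm)
    linarith

open scoped Classical in
/-- The coordinate at `v` can be chosen as the least one that satisfies all cut inequalities. -/
theorem exists_least_add_single {V E : Type*} [Fintype V] [Fintype E] {s t : E → V} {v : V}
    {a : V ⊕ E → ℤ}
    (ha : ∀ c : V → ℤ, (∀ i, c i = 0 ∨ c i = 1) → c v = 0 → 0 ≤ cutValue s t a c) :
    ∃ p : ℤ, a + Pi.single (Sum.inl v) p ∈ cutPoints s t ∧
      ∃ c : V → ℤ, (∀ i, c i = 0 ∨ c i = 1) ∧ c v = 1 ∧ cutValue s t a c + p ≤ 0 := by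
  have hfin : {c : V → ℤ | ∀ i, c i = 0 ∨ c i = 1}.Finite := by
    refine (Set.finite_Icc (0 : V → ℤ) 1).subset fun c hc => ⟨fun i => ?_, fun i => ?_⟩ <;>
      rcases hc i with h | h <;> simp [h]
  obtain ⟨c₁, ⟨hc₁, hv⟩, hmin⟩ := Set.exists_min_image
    {c : V → ℤ | (∀ i, c i = 0 ∨ c i = 1) ∧ c v = 1} (cutValue s t a)
    (hfin.subset fun c hc => hc.1) ⟨fun _ => 1, fun _ => Or.inr rfl, rfl⟩
  refine ⟨-cutValue s t a c₁, fun c hc => ?_, c₁, hc₁, hv, by simp⟩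
  rw [cutValue_add_single]
  rcases hc v with h | h
  · simpa [h] using ha c hc h
  · have := hmin c ⟨hc, h⟩
    rw [h]
    linarith

open scoped Classical in
/-- Integrality of the decomposition: every point of the glued graph splits into integer points of
the two summands. -/
theorem exists_gluePoint_minimal {x : (V₁ ⊕ {j : V₂ // j ≠ w}) ⊕ (E₁ ⊕ E₂) → ℤ}
    (hx : x ∈ cutPoints (glueEnd v w s₁ s₂) (glueEnd v w t₁ t₂)) :
    ∃ (a : V₁ ⊕ E₁ → ℤ) (b : V₂ ⊕ E₂ → ℤ), gluePoint v w a b = x ∧ a ∈ cutPoints s₁ t₁ ∧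
      a - Pi.single (Sum.inl v) 1 ∉ cutPoints s₁ t₁ ∧ b ∈ cutPoints s₂ t₂ := by
  obtain ⟨a₀, b₀, hab⟩ := exists_gluePoint_eq (v := v) x
  -- a cut of the first summand avoiding `v` is also a cut of the glued graph
  have havoid : ∀ c : V₁ → ℤ, (∀ i, c i = 0 ∨ c i = 1) → c v = 0 → 0 ≤ cutValue s₁ t₁ a₀ c := by
    intro c hc h
    have h1 := hx (Sum.elim c fun _ => 0) (by rintro (i | j); exacts [hc i, Or.inl rfl])
    rw [← hab, cutValue_gluePoint] at h1
    simp only [sumElim_glueVertex c (fun _ => (0 : ℤ)) h, cutValue_zero, add_zero,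
      Sum.elim_inl] at h1
    exact h1
  obtain ⟨p, hp, c₁, hc₁, hv, htight⟩ := exists_least_add_single havoid
  have hx' : gluePoint v w (a₀ + Pi.single (Sum.inl v) p)
      (b₀ + Pi.single (Sum.inl w) (-p)) = x := by
    rw [← gluePoint_add_single, add_assoc, ← Pi.single_add, add_neg_cancel, Pi.single_zero,
      add_zero, hab]
  have htight' : cutValue s₁ t₁ (a₀ + Pi.single (Sum.inl v) p) c₁ ≤ 0 := by
    rw [cutValue_add_single, hv, mul_one]
    exact htight
  refine ⟨_, _, hx', hp, fun h => ?_, mem_cutPoints_of_gluePoint_mem (hx' ▸ hx) hc₁ hv htight'⟩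
  have h2 := cutValue_add_single (s := s₁) (t := t₁)
    (a₀ + Pi.single (Sum.inl v) p - Pi.single (Sum.inl v) 1) v 1 c₁
  rw [sub_add_cancel, hv] at h2
  linarith [h c₁ hc₁]

/-- The map `gluePoint` is a bijection from pairs of a minimal point of the first summand and an
arbitrary point of the second onto the points of the glued graph. -/
theorem ncard_cutLayer_glue (hinc₁ : ∀ i, ∃ f, s₁ f = i ∨ t₁ f = i)
    (hinc₂ : ∀ i, ∃ f, s₂ f = i ∨ t₂ f = i) (n : ℕ) :
    (cutLayer (glueEnd v w s₁ s₂) (glueEnd v w t₁ t₂) n).ncard =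
      ∑ q ∈ Finset.HasAntidiagonal.antidiagonal n,
        (minimalLayer s₁ t₁ v q.1).ncard * (cutLayer s₂ t₂ q.2).ncard := by
  classical
  set Q : ℕ × ℕ → Set ((V₁ ⊕ E₁ → ℤ) × (V₂ ⊕ E₂ → ℤ)) :=
    fun q => minimalLayer s₁ t₁ v q.1 ×ˢ cutLayer s₂ t₂ q.2 with hQ
  have hfin : ∀ q, (Q q).Finite := fun q =>
    ((finite_cutLayer hinc₁ q.1).subset fun x hx => hx.1).prod (finite_cutLayer hinc₂ q.2)
  have hbij : Set.BijOn (fun q => gluePoint v w q.1 q.2)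
      (⋃ q ∈ (Finset.HasAntidiagonal.antidiagonal n : Set (ℕ × ℕ)), Q q)
      (cutLayer (glueEnd v w s₁ s₂) (glueEnd v w t₁ t₂) n) := by
    refine ⟨?_, ?_, ?_⟩
    · rintro ⟨a, b⟩ hab
      simp only [Set.mem_iUnion] at hab
      obtain ⟨q, hq, ⟨⟨ha, ha'⟩, -⟩, hb, hb'⟩ := hab
      refine ⟨gluePoint_mem_cutPoints ha hb, ?_⟩
      rw [sum_gluePoint]
      simp only at ha' hb'
      rw [ha', hb', ← Finset.HasAntidiagonal.mem_antidiagonal.1 (Finset.mem_coe.1 hq)]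
      push_cast
      rfl
    · -- the coordinate at `v` of a minimal point is determined by the other coordinates
      have hle : ∀ a a' : V₁ ⊕ E₁ → ℤ, ∀ b b' : V₂ ⊕ E₂ → ℤ,
          gluePoint v w a b = gluePoint v w a' b' → a ∈ cutPoints s₁ t₁ →
          a' - Pi.single (Sum.inl v) 1 ∉ cutPoints s₁ t₁ → a' (Sum.inl v) ≤ a (Sum.inl v) := by
        intro a a' b b' h ha ha'
        by_contra hlt
        push Not at hlt
        set d := a' (Sum.inl v) - a (Sum.inl v) with hd
        have h1 : gluePoint v w (a + Pi.single (Sum.inl v) d) (b - Pi.single (Sum.inl w) d) =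
            gluePoint v w a' b' := by
          rw [gluePoint_add_single, sub_add_cancel, h]
        have h2 := (eq_of_gluePoint_eq h1 (by simp [hd])).1
        apply ha'
        rw [← h2, add_sub_assoc, ← Pi.single_sub]
        exact add_single_mem_cutPoints ha v (by omega)
      rintro ⟨a, b⟩ hab ⟨a', b'⟩ hab' h
      simp only [Set.mem_iUnion] at hab hab'
      obtain ⟨q, -, ⟨⟨ha, -⟩, hm⟩, -⟩ := hab
      obtain ⟨q', -, ⟨⟨ha', -⟩, hm'⟩, -⟩ := hab'
      have h3 := eq_of_gluePoint_eq h
        (le_antisymm (hle _ _ _ _ h.symm ha' hm) (hle _ _ _ _ h ha hm'))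
      exact Prod.ext h3.1 h3.2
    · rintro x ⟨hx, hxn⟩
      obtain ⟨a, b, rfl, ha, hm, hb⟩ := exists_gluePoint_minimal hx
      rw [sum_gluePoint] at hxn
      obtain ⟨i, hi⟩ := Int.eq_ofNat_of_zero_le (sum_nonneg_of_mem_cutPoints ha).1
      obtain ⟨j, hj⟩ := Int.eq_ofNat_of_zero_le (sum_nonneg_of_mem_cutPoints hb).1
      refine ⟨(a, b), ?_, rfl⟩
      simp only [Set.mem_iUnion]
      refine ⟨(i, j), ?_, ⟨⟨ha, hi⟩, hm⟩, hb, hj⟩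
      rw [Finset.mem_coe, Finset.HasAntidiagonal.mem_antidiagonal]
      omega
  rw [← hbij.ncard_eq, Set.Finite.ncard_biUnion (Finset.finite_toSet _) fun q _ => hfin q]
  · rw [finsum_mem_coe_finset]
    exact Finset.sum_congr rfl fun q _ => Set.ncard_prod
  · intro q _ q' _ hne
    rw [Function.onFun, Set.disjoint_left]
    rintro ⟨a, b⟩ ⟨⟨⟨-, h1⟩, -⟩, -, h2⟩ ⟨⟨⟨-, h1'⟩, -⟩, -, h2'⟩
    apply hne
    simp only at h1 h2 h1' h2'
    rw [h1] at h1'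
    rw [h2] at h2'
    exact Prod.ext (by exact_mod_cast h1') (by exact_mod_cast h2')

/-- Gluing along a vertex multiplies the lattice point series, up to the factor `1 - z`. -/
theorem cutSeries_glue (hinc₁ : ∀ i, ∃ f, s₁ f = i ∨ t₁ f = i)
    (hinc₂ : ∀ i, ∃ f, s₂ f = i ∨ t₂ f = i) :
    cutSeries (glueEnd v w s₁ s₂) (glueEnd v w t₁ t₂) =
      (1 - PowerSeries.X) * cutSeries s₁ t₁ * cutSeries s₂ t₂ := by
  rw [← mk_ncard_minimalLayer hinc₁ v]
  ext n
  rw [PowerSeries.coeff_mul, cutSeries, PowerSeries.coeff_mk, ncard_cutLayer_glue hinc₁ hinc₂]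
  simp [cutSeries]

end

/-! ### Dimension, and the polytope of a 1-sum -/

theorem latticePolytope_comp_equiv {ι κ κ' : Type*} (g : κ → ι → ℤ) (e : κ' ≃ κ) :
    latticePolytope (g ∘ e) = latticePolytope g := by
  rw [latticePolytope, latticePolytope]
  congr 1
  exact e.surjective.range_comp fun i k => (g i k : ℝ)

open scoped Classical in
/-- Every unit vector is a lattice point of the polytope, as the midpoint of two generators. -/
theorem single_mem_latticePolytope {V E : Type*} {s t : E → V}
    (hinc : ∀ i, ∃ f, s f = i ∨ t f = i) (k : V ⊕ E) :
    (Pi.single k 1 : V ⊕ E → ℝ) ∈ latticePolytope (edgeGen s t) := by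
  have hmid : ∀ q q' : E × Fin 3, (∀ l, edgeGen s t q l + edgeGen s t q' l =
      2 * (Pi.single k 1 : V ⊕ E → ℤ) l) →
      (Pi.single k 1 : V ⊕ E → ℝ) ∈ latticePolytope (edgeGen s t) := by
    intro q q' h
    have h1 : (Pi.single k 1 : V ⊕ E → ℝ) =
        midpoint ℝ (fun l => (edgeGen s t q l : ℝ)) fun l => (edgeGen s t q' l : ℝ) := by
      ext l
      have h2 : (edgeGen s t q l : ℝ) + edgeGen s t q' l =
          2 * ((Pi.single k 1 : V ⊕ E → ℤ) l : ℝ) := by exact_mod_cast h l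
      have h3 : ((Pi.single k 1 : V ⊕ E → ℤ) l : ℝ) = (Pi.single k 1 : V ⊕ E → ℝ) l := by
        simp only [Pi.single_apply]
        split_ifs <;> simp
      rw [h3] at h2
      simp [midpoint_eq_smul_add, h2]
    rw [h1]
    exact (convex_convexHull ℝ _).midpoint_mem (subset_convexHull ℝ _ ⟨q, rfl⟩)
      (subset_convexHull ℝ _ ⟨q', rfl⟩)
  rcases k with i | f
  · obtain ⟨f, rfl | rfl⟩ := hinc i
    · exact hmid (f, 0) (f, 1) fun l => by simp [edgeGen]; ring
    · exact hmid (f, 0) (f, 2) fun l => by simp [edgeGen]; ring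
  · exact hmid (f, 1) (f, 2) fun l => by simp [edgeGen]; ring

section

variable {V E : Type*} [Fintype V] [Fintype E] {s t : E → V}

theorem ehrhartSeries_edgeGen [Nonempty E] (hinc : ∀ i, ∃ f, s f = i ∨ t f = i) :
    ehrhartSeries (latticePolytope (edgeGen s t)) = cutSeries s t := by
  ext n
  rw [coeff_ehrhartSeries_latticePolytope, cutSeries, PowerSeries.coeff_mk]
  congr 2
  ext x
  exact mem_coneLayer_edgeGen_iff hinc

theorem hasPoleOrderLE_edgeGen [Nonempty E] (s t : E → V) :
    HasPoleOrderLE (Fintype.card (V ⊕ E)) (ehrhartSeries (latticePolytope (edgeGen s t))) := by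
  have e := (Fintype.equivFin (E × Fin 3)).symm
  have : Nonempty (V ⊕ E) := ⟨Sum.inr (Classical.arbitrary E)⟩
  have : NeZero (Fintype.card (E × Fin 3)) := ⟨Fintype.card_ne_zero⟩
  rw [← latticePolytope_comp_equiv _ e]
  exact hasPoleOrderLE_ehrhartSeries _ fun i => sum_edgeGen s t (e i)

theorem sum_of_mem_latticePolytope {p : V ⊕ E → ℝ} (hp : p ∈ latticePolytope (edgeGen s t)) :
    ∑ k, p k = 1 := by
  obtain ⟨u, -, h2, h3⟩ := (mem_latticePolytope_iff _ p).1 hp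
  simp_rw [h3]
  rw [Finset.sum_comm, ← h2]
  refine Finset.sum_congr rfl fun q _ => ?_
  have h4 : (∑ k, (edgeGen s t q k : ℝ)) = 1 := by exact_mod_cast sum_edgeGen s t q
  rw [← Finset.mul_sum, h4, mul_one]

/-- The polytope spans the affine hyperplane of coordinate sum `1`. -/
theorem polytopeDim_edgeGen [Nonempty E] (hinc : ∀ i, ∃ f, s f = i ∨ t f = i) :
    polytopeDim (latticePolytope (edgeGen s t)) + 1 = Fintype.card V + Fintype.card E := by
  classical
  set σ : Module.Dual ℝ (V ⊕ E → ℝ) := ∑ k, LinearMap.proj k with hσ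
  have hσ' : ∀ y, σ y = ∑ k, y k := fun y => by simp [hσ]
  set k₀ : V ⊕ E := Sum.inr (Classical.arbitrary E)
  have hker : vectorSpan ℝ (latticePolytope (edgeGen s t)) = LinearMap.ker σ := by
    apply le_antisymm
    · rw [vectorSpan, Submodule.span_le]
      rintro _ ⟨p, hp, q, hq, rfl⟩
      show σ (p - q) = 0
      rw [map_sub, hσ', hσ',
        sum_of_mem_latticePolytope hp, sum_of_mem_latticePolytope hq, sub_self]
    · intro y hy
      have hy' : ∑ k, y k = 0 := by rw [← hσ']; exact hy
      have h1 : y = ∑ k, y k • ((Pi.single k 1 : V ⊕ E → ℝ) - Pi.single k₀ 1) := by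
        simp only [smul_sub, Finset.sum_sub_distrib, ← Finset.sum_smul, hy', zero_smul, sub_zero]
        exact pi_eq_sum_univ' y
      rw [h1]
      exact Submodule.sum_mem _ fun k _ => Submodule.smul_mem _ _
        (vsub_mem_vectorSpan ℝ (single_mem_latticePolytope hinc k)
          (single_mem_latticePolytope hinc k₀))
  have hne : σ ≠ 0 := by
    intro h
    have := hσ' (Pi.single k₀ 1)
    simp [h] at this
  rw [polytopeDim, direction_affineSpan, hker, Module.Dual.finrank_ker_add_one_of_ne_zero hne,
    Module.finrank_fintype_fun_eq_card, Fintype.card_sum]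

variable {V' E' : Type*} [Fintype V'] [Fintype E']

theorem cutSeries_equiv (eV : V ≃ V') (eE : E ≃ E') (s t : E → V) :
    cutSeries (fun f => eV (s (eE.symm f))) (fun f => eV (t (eE.symm f))) = cutSeries s t := by
  have hval : ∀ (x : V' ⊕ E' → ℤ) (c : V' → ℤ),
      cutValue (fun f => eV (s (eE.symm f))) (fun f => eV (t (eE.symm f))) x c =
        cutValue s t (x ∘ Equiv.sumCongr eV eE) (c ∘ eV) := by
    intro x c
    simp only [cutValue]
    congr 1
    · exact (Equiv.sum_comp eV fun i => c i * x (Sum.inl i)).symm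
    · rw [← Equiv.sum_comp eE]
      simp
  ext n
  rw [cutSeries, cutSeries, PowerSeries.coeff_mk, PowerSeries.coeff_mk, Nat.cast_inj]
  refine Set.BijOn.ncard_eq (f := fun x => x ∘ Equiv.sumCongr eV eE) ⟨?_, ?_, ?_⟩
  · rintro x ⟨hx, hsum⟩
    refine ⟨fun c hc => ?_, ?_⟩
    · have := hx (c ∘ eV.symm) fun i => hc _
      rw [hval] at this
      simpa [Function.comp_assoc] using this
    · rw [← hsum]
      exact Equiv.sum_comp (Equiv.sumCongr eV eE) x
  · intro x _ y _ h
    exact (Equiv.sumCongr eV eE).surjective.injective_comp_right h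
  · rintro x ⟨hx, hsum⟩
    have hcomp : (x ∘ (Equiv.sumCongr eV eE).symm) ∘ Equiv.sumCongr eV eE = x := by
      ext k; simp
    refine ⟨x ∘ (Equiv.sumCongr eV eE).symm, ⟨fun c hc => ?_, ?_⟩, hcomp⟩
    · rw [hval, hcomp]
      exact hx _ fun i => hc _
    · rw [← hsum]
      exact Equiv.sum_comp (Equiv.sumCongr eV eE).symm x

end

section

variable {α β : Type*} {G : Graph α β}

/-- The three generators at an edge do not depend on the order in which its ends are listed. -/
theorem cosmologicalPolytope_eq {s t : G.edgeSet → G.vertexSet}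
    (hst : ∀ f : G.edgeSet, G.IsLink f (s f) (t f)) :
    cosmologicalPolytope G = latticePolytope (edgeGen s t) := by
  classical
  have hgen : ∀ (f : G.edgeSet) (k : Fin 3),
      (fun l => (edgeGen s t (f, k) l : ℝ)) =
        (if k = 2 then -1 else 1 : ℝ) • unitVec (Sum.inl (s f)) +
        (if k = 1 then -1 else 1 : ℝ) • unitVec (Sum.inl (t f)) +
        (if k = 0 then -1 else 1 : ℝ) • unitVec (Sum.inr f) := by
    intro f k
    ext l
    have h : ∀ (_ : DecidableEq (G.vertexSet ⊕ G.edgeSet)) (l' : G.vertexSet ⊕ G.edgeSet),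
        ((Pi.single l' 1 : G.vertexSet ⊕ G.edgeSet → ℤ) l : ℝ) = unitVec l' l := by
      intro _ l'
      by_cases hl : l = l'
      · subst hl; simp [unitVec]
      · simp [unitVec, hl]
    simp only [edgeGen, Pi.add_apply, Pi.smul_apply, smul_eq_mul]
    push_cast
    rw [h, h, h]
  rw [cosmologicalPolytope, latticePolytope]
  congr 1
  ext p
  constructor
  · rintro ⟨f, i, j, hij, hp⟩
    rcases hij.eq_and_eq_or_eq_and_eq (hst f) with ⟨h1, h2⟩ | ⟨h1, h2⟩
    · rw [Subtype.ext h1, Subtype.ext h2] at hp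
      rcases hp with rfl | rfl | rfl
      · exact ⟨(f, 0), by simp only [hgen]; simp [sub_eq_add_neg]⟩
      · exact ⟨(f, 1), by simp only [hgen]; simp [sub_eq_add_neg]⟩
      · exact ⟨(f, 2), by simp only [hgen]; simp⟩
    · rw [Subtype.ext h1, Subtype.ext h2] at hp
      rcases hp with rfl | rfl | rfl
      · exact ⟨(f, 0), by simp only [hgen]; simp; abel⟩
      · exact ⟨(f, 2), by simp only [hgen]; simp; abel⟩
      · exact ⟨(f, 1), by simp only [hgen]; simp; abel⟩
  · rintro ⟨⟨f, k⟩, rfl⟩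
    refine ⟨f, s f, t f, hst f, ?_⟩
    simp only [hgen]
    obtain rfl | rfl | rfl : k = 0 ∨ k = 1 ∨ k = 2 := by fin_cases k <;> simp
    · left; simp [sub_eq_add_neg]
    · right; left; simp [sub_eq_add_neg]
    · right; right; simp

theorem exists_ends (G : Graph α β) :
    ∃ s t : G.edgeSet → G.vertexSet, ∀ f : G.edgeSet, G.IsLink f (s f) (t f) := by
  have h : ∀ f : G.edgeSet, ∃ i j : G.vertexSet, G.IsLink f i j := by
    rintro ⟨f, hf⟩
    obtain ⟨i, j, hij⟩ := (G.edge_mem_iff_exists_isLink f).1 hf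
    exact ⟨⟨i, hij.left_mem⟩, ⟨j, hij.right_mem⟩, hij⟩
  choose s t h using h
  exact ⟨s, t, h⟩

theorem exists_end_eq (hG : NoIsolatedVertices G) {s t : G.edgeSet → G.vertexSet}
    (hst : ∀ f : G.edgeSet, G.IsLink f (s f) (t f)) (i : G.vertexSet) : ∃ f, s f = i ∨ t f = i := by
  obtain ⟨f, j, hij⟩ := hG i i.2
  refine ⟨⟨f, hij.edge_mem⟩, ?_⟩
  rcases G.eq_or_eq_of_isLink_of_isLink hij (hst ⟨f, hij.edge_mem⟩) with h | h
  · exact Or.inl (Subtype.ext h.symm)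
  · exact Or.inr (Subtype.ext h.symm)

end

section

variable {α₁ α₂ β₁ β₂ : Type*} (G₁ : Graph α₁ β₁) (G₂ : Graph α₂ β₂) (v : G₁.vertexSet)
  (w : G₂.vertexSet)

theorem glueLeft_mem (i : G₁.vertexSet) :
    glueLeft α₂ v.1 i.1 ∈ (oneSum G₁ G₂ v.1 w.1).vertexSet := by
  by_cases h : i.1 = v.1
  · exact Or.inl (by simp [glueLeft, h])
  · exact Or.inr ⟨Sum.inl i, Or.inl ⟨i, ⟨i.2, h⟩, rfl⟩, by simp [glueLeft, h]⟩

theorem glueRight_mem (i : G₂.vertexSet) :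
    glueRight α₁ w.1 i.1 ∈ (oneSum G₁ G₂ v.1 w.1).vertexSet := by
  by_cases h : i.1 = w.1
  · exact Or.inl (by simp [glueRight, h])
  · exact Or.inr ⟨Sum.inr i, Or.inr ⟨i, ⟨i.2, h⟩, rfl⟩, by simp [glueRight, h]⟩

/-- The vertices of the 1-sum, with the glued vertex represented by `v`. -/
noncomputable def oneSumVertexEquiv :
    G₁.vertexSet ⊕ {j : G₂.vertexSet // j ≠ w} ≃ (oneSum G₁ G₂ v.1 w.1).vertexSet :=
  Equiv.ofBijective
    (Sum.elim (fun i => ⟨glueLeft α₂ v.1 i.1, glueLeft_mem G₁ G₂ v w i⟩)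
      fun j => ⟨glueRight α₁ w.1 j.1.1, glueRight_mem G₁ G₂ v w j.1⟩) (by
    have hne : ∀ j : {j : G₂.vertexSet // j ≠ w}, j.1.1 ≠ w.1 := fun j h => j.2 (Subtype.ext h)
    constructor
    · rintro (i | j) (i' | j') h <;>
        simp only [Sum.elim_inl, Sum.elim_inr, Subtype.mk.injEq, glueLeft, glueRight] at h
      · split_ifs at h with h1 h2 h2
        · exact congrArg _ (Subtype.ext (h1.trans h2.symm))
        · simpa [Subtype.ext_iff] using h
      · rw [if_neg (hne j')] at h
        split_ifs at h
        simp at h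
      · rw [if_neg (hne j)] at h
        split_ifs at h
        simp at h
      · rw [if_neg (hne j), if_neg (hne j')] at h
        simpa [Subtype.ext_iff] using h
    · rintro ⟨x, rfl | ⟨_, ⟨i, ⟨hi, hiv⟩, rfl⟩ | ⟨j, ⟨hj, hjw⟩, rfl⟩, rfl⟩⟩
      · exact ⟨Sum.inl v, Subtype.ext (by simp [glueLeft])⟩
      · have : i ≠ v.1 := hiv
        exact ⟨Sum.inl ⟨i, hi⟩, Subtype.ext (by simp [glueLeft, this])⟩
      · have : j ≠ w.1 := hjw
        exact ⟨Sum.inr ⟨⟨j, hj⟩, fun h => this (congrArg Subtype.val h)⟩,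
          Subtype.ext (by simp [glueRight, this])⟩)

/-- The edges of the 1-sum. -/
noncomputable def oneSumEdgeEquiv :
    G₁.edgeSet ⊕ G₂.edgeSet ≃ (oneSum G₁ G₂ v.1 w.1).edgeSet :=
  Equiv.ofBijective
    (Sum.elim (fun e => ⟨Sum.inl e.1, Or.inl ⟨e.1, e.2, rfl⟩⟩)
      fun e => ⟨Sum.inr e.1, Or.inr ⟨e.1, e.2, rfl⟩⟩) (by
    constructor
    · rintro (e | e) (e' | e') h 
      · simpa [Subtype.ext_iff] using h
      · cases congrArg Subtype.val h
      · cases congrArg Subtype.val h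
      · simpa [Subtype.ext_iff] using h
    · rintro ⟨x, ⟨e, he, rfl⟩ | ⟨e, he, rfl⟩⟩
      · exact ⟨Sum.inl ⟨e, he⟩, rfl⟩
      · exact ⟨Sum.inr ⟨e, he⟩, rfl⟩)

variable {G₁ G₂ v w}

theorem oneSumVertexEquiv_glueVertex (j : G₂.vertexSet) :
    (oneSumVertexEquiv G₁ G₂ v w (glueVertex v w j)).1 = glueRight α₁ w.1 j.1 := by
  classical
  rw [glueVertex]
  split_ifs with h
  · subst h
    simp [oneSumVertexEquiv, glueLeft, glueRight]
  · rfl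

theorem isLink_oneSum {s₁ t₁ : G₁.edgeSet → G₁.vertexSet} {s₂ t₂ : G₂.edgeSet → G₂.vertexSet}
    (h₁ : ∀ f : G₁.edgeSet, G₁.IsLink f (s₁ f) (t₁ f))
    (h₂ : ∀ f : G₂.edgeSet, G₂.IsLink f (s₂ f) (t₂ f))
    (f : G₁.edgeSet ⊕ G₂.edgeSet) :
    (oneSum G₁ G₂ v.1 w.1).IsLink (oneSumEdgeEquiv G₁ G₂ v w f)
      (oneSumVertexEquiv G₁ G₂ v w (glueEnd v w s₁ s₂ f))
      (oneSumVertexEquiv G₁ G₂ v w (glueEnd v w t₁ t₂ f)) := by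
  rcases f with e | e
  · exact ⟨_, _, h₁ e, rfl, rfl⟩
  · exact ⟨_, _, h₂ e, oneSumVertexEquiv_glueVertex _, oneSumVertexEquiv_glueVertex _⟩

theorem exists_glueEnd_eq {V₁ V₂ E₁ E₂ : Type*} {v : V₁} {w : V₂} {s₁ t₁ : E₁ → V₁}
    {s₂ t₂ : E₂ → V₂} (h₁ : ∀ i, ∃ f, s₁ f = i ∨ t₁ f = i) (h₂ : ∀ i, ∃ f, s₂ f = i ∨ t₂ f = i)
    (i : V₁ ⊕ {j : V₂ // j ≠ w}) :
    ∃ f, glueEnd v w s₁ s₂ f = i ∨ glueEnd v w t₁ t₂ f = i := by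
  rcases i with i | j
  · obtain ⟨f, rfl | rfl⟩ := h₁ i
    exacts [⟨Sum.inl f, Or.inl rfl⟩, ⟨Sum.inl f, Or.inr rfl⟩]
  · obtain ⟨f, h | h⟩ := h₂ j
    · exact ⟨Sum.inr f, Or.inl ((congrArg _ h).trans (glueVertex_coe j))⟩
    · exact ⟨Sum.inr f, Or.inr ((congrArg _ h).trans (glueVertex_coe j))⟩

end

end Cosmological

theorem mainTheorem2 {α₁ α₂ β₁ β₂ : Type*} (G₁ : Graph α₁ β₁) (G₂ : Graph α₂ β₂)
    (hV₁ : G₁.vertexSet.Finite) (hE₁ : G₁.edgeSet.Finite)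
    (hV₂ : G₂.vertexSet.Finite) (hE₂ : G₂.edgeSet.Finite)
    (hG₁ : Cosmological.NoIsolatedVertices G₁) (hG₂ : Cosmological.NoIsolatedVertices G₂)
    (v : α₁) (hv : v ∈ G₁.vertexSet) (w : α₂) (hw : w ∈ G₂.vertexSet) :
    ∃ h h₁ h₂ : Polynomial ℤ,
      Cosmological.IsHStarPolynomial
        (Cosmological.cosmologicalPolytope (Cosmological.oneSum G₁ G₂ v w)) h ∧
      Cosmological.IsHStarPolynomial (Cosmological.cosmologicalPolytope G₁) h₁ ∧
      Cosmological.IsHStarPolynomial (Cosmological.cosmologicalPolytope G₂) h₂ ∧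
      h = h₁ * h₂ := by
  classical
  obtain ⟨s₁, t₁, hst₁⟩ := Cosmological.exists_ends G₁
  obtain ⟨s₂, t₂, hst₂⟩ := Cosmological.exists_ends G₂
  have hinc₁ := Cosmological.exists_end_eq hG₁ hst₁
  have hinc₂ := Cosmological.exists_end_eq hG₂ hst₂
  set v' : G₁.vertexSet := ⟨v, hv⟩ with hv'
  set w' : G₂.vertexSet := ⟨w, hw⟩ with hw'
  have : Fintype G₁.vertexSet := hV₁.fintype
  have : Fintype G₂.vertexSet := hV₂.fintype
  have : Fintype G₁.edgeSet := hE₁.fintype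
  have : Fintype G₂.edgeSet := hE₂.fintype
  set eV := Cosmological.oneSumVertexEquiv G₁ G₂ v' w' with heV
  set eE := Cosmological.oneSumEdgeEquiv G₁ G₂ v' w' with heE
  have : Fintype (Cosmological.oneSum G₁ G₂ v w).vertexSet := Fintype.ofEquiv _ eV
  have : Fintype (Cosmological.oneSum G₁ G₂ v w).edgeSet := Fintype.ofEquiv _ eE
  have : Nonempty G₁.edgeSet := ⟨(hinc₁ v').choose⟩
  have : Nonempty G₂.edgeSet := ⟨(hinc₂ w').choose⟩
  have : Nonempty (Cosmological.oneSum G₁ G₂ v w).edgeSet := eE.symm.nonempty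
  -- ends of the edges of the 1-sum
  set s : (Cosmological.oneSum G₁ G₂ v w).edgeSet → (Cosmological.oneSum G₁ G₂ v w).vertexSet :=
    fun f => eV (Cosmological.glueEnd v' w' s₁ s₂ (eE.symm f)) with hs
  set t : (Cosmological.oneSum G₁ G₂ v w).edgeSet → (Cosmological.oneSum G₁ G₂ v w).vertexSet :=
    fun f => eV (Cosmological.glueEnd v' w' t₁ t₂ (eE.symm f)) with ht
  have hst : ∀ f : (Cosmological.oneSum G₁ G₂ v w).edgeSet,
      (Cosmological.oneSum G₁ G₂ v w).IsLink f (s f) (t f) := by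
    intro f
    have := Cosmological.isLink_oneSum (v := v') (w := w') hst₁ hst₂ (eE.symm f)
    rw [← heE, Equiv.apply_symm_apply] at this
    exact this
  have hinc : ∀ i, ∃ f, s f = i ∨ t f = i := by
    intro i
    obtain ⟨f, hf⟩ := Cosmological.exists_glueEnd_eq (v := v') (w := w') hinc₁ hinc₂ (eV.symm i)
    refine ⟨eE f, ?_⟩
    simpa only [hs, ht, Equiv.symm_apply_apply, ← Equiv.eq_symm_apply] using hf
  obtain ⟨h₁, hh₁⟩ := Cosmological.hasPoleOrderLE_edgeGen s₁ t₁
  obtain ⟨h₂, hh₂⟩ := Cosmological.hasPoleOrderLE_edgeGen s₂ t₂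
  have hcard : Fintype.card (Cosmological.oneSum G₁ G₂ v w).vertexSet +
      Fintype.card (Cosmological.oneSum G₁ G₂ v w).edgeSet + 1 =
      Fintype.card (G₁.vertexSet ⊕ G₁.edgeSet) + Fintype.card (G₂.vertexSet ⊕ G₂.edgeSet) := by
    rw [← Fintype.card_congr eV, ← Fintype.card_congr eE, Fintype.card_sum, Fintype.card_sum,
      Fintype.card_sum, Fintype.card_sum, Fintype.card_subtype_compl, Fintype.card_subtype_eq]
    have : 0 < Fintype.card G₂.vertexSet := Fintype.card_pos_iff.2 ⟨w'⟩
    omega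
  refine ⟨h₁ * h₂, h₁, h₂, ?_, ?_, ?_, rfl⟩
  · rw [Cosmological.IsHStarPolynomial, Cosmological.cosmologicalPolytope_eq hst,
      Cosmological.polytopeDim_edgeGen hinc, Cosmological.ehrhartSeries_edgeGen hinc,
      Cosmological.cutSeries_equiv, Cosmological.cutSeries_glue hinc₁ hinc₂, Polynomial.coe_mul,
      ← hh₁, ← hh₂, Cosmological.ehrhartSeries_edgeGen hinc₁,
      Cosmological.ehrhartSeries_edgeGen hinc₂, mul_mul_mul_comm, ← pow_add, ← hcard, pow_succ]
    ring
  · rw [Cosmological.IsHStarPolynomial, Cosmological.cosmologicalPolytope_eq hst₁,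
      Cosmological.polytopeDim_edgeGen hinc₁, ← hh₁, Fintype.card_sum]
  · rw [Cosmological.IsHStarPolynomial, Cosmological.cosmologicalPolytope_eq hst₂,
      Cosmological.polytopeDim_edgeGen hinc₂, ← hh₂, Fintype.card_sum]
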